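/- Let $A\in\mathbb{R}^{2\times 2}$ be invertible, $R_\phi$ the rotation of $\mathbb{R}^2$ by the angle $\phi$, $J=R_{-\pi/2}$, $A_0=JA$, and let $\Gamma_0=\mathbb{R}^2/A_0\mathbb{Z}^2$. Let $W^{1,2}_0(\Gamma_0)$ be the space of ($A_0\mathbb{Z}^2$-periodic) vector fields $\mathbf u\in W^{1,2}(\Gamma_0;\mathbb{R}^2)$ with $\int_{\Gamma_0}\mathbf u=\mathbf 0$, with norm $\Vert\mathbf u\Vert_{1,2}=\big(\int_{\Gamma_0}|\mathbf u|^2+|\nabla\mathbf u|^2\big)^{1/2}$, and $\varepsilon(\mathbf u)=\frac12(\nabla\mathbf u+\nabla\mathbf u^T)$. For Lamé parameters $\lambda,\mu$ with $\mu>0$, $\lambda+\mu\ge0$, a function $\Psi_0:\Gamma_0\to\mathbb{R}$ (the generalized stacking fault energy, GSFE) with minimum $\Psi_{\min}$, and a twist angle $\theta$, consider the rescaled relaxation energy $\mathcal{E}^\theta_0[\mathbf u]=2\mathcal{E}^0_{\mathrm{intra}}[\mathbf u]+\mathcal{E}^\theta_{\mathrm{inter}}[2\mathbf u]$, where \[ \mathcal{E}^0_{\mathrm{intra}}[\mathbf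 u]=\int_{\Gamma_0}\tfrac{\lambda}{2}(\operatorname{div}\mathbf u)^2+\mu\,\varepsilon(\mathbf u):\varepsilon(\mathbf u), \] \[ \mathcal{E}^\theta_{\mathrm{inter}}[\mathbf v]=\frac{1}{4\sin^2(\theta/2)}\int_{\Gamma_0}\tfrac12\Big(\Psi_0(\mathbf x-JR_{\theta/2}\mathbf v(\mathbf x))+\Psi_0(\mathbf x-JR_{-\theta/2}\mathbf v(\mathbf x))\Big)\,d\mathbf x. \] **Theorem 4.1.** There is a constant $C_A^1>0$ depending only on $A$, namely the largest constant for which the Korn-type inequality \[ \int_{\Gamma_0}\lambda(\operatorname{div}\mathbf u)^2+2\mu\,\varepsilon(\mathbf u):\varepsilon(\mathbf u)\ \ge\ \mu\,C_A^1\,\Vert\mathbf u\Vert_{1,2}^2 \] holds for all $\mathbf u\in W^{1,2}_0(\Gamma_0)$ and all $\lambda,\mu$ with $\mu>0$, $\lambda+\mu\ge 0$, such that the following holds for all such $\lambda,\mu$, every twice continuously differentiable $\Psi_0:\Gamma_0\to\mathbb{R}$ and every $\theta\in\mathbb{R}$ that is not an integer multiple of $\pi$. The energy $\mathcal{E}^\theta_0$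 has a minimizer in $W^{1,2}_0(\Gamma_0)$, and every minimizer $\mathbf u^*$ of $\mathcal{E}^\theta_0$ in $W^{1,2}_0(\Gamma_0)$ satisfies \[ \Vert\mathbf u^*\Vert_{1,2}\le\frac{1}{2|\sin(\theta/2)|}\left(\frac{1}{\mu C_A^1}\int_{\Gamma_0}\big[\Psi_0(\mathbf x)-\Psi_{\min}\big]\,d\mathbf x\right)^{1/2}. \] In particular, the $L^2$ norm of the gradient grows at most inversely linearly in $\theta$: if moreover $|\theta|<\pi$, then \[ \Vert\nabla\mathbf u^*\Vert_{L^2(\Gamma_0)}\le\frac{\pi}{2|\theta|}\left(\frac{1}{\mu C_A^1}\int_{\Gamma_0}\big[\Psi_0(\mathbf x)-\Psi_{\min}\big]\,d\mathbf x\right)^{1/2}. \] -/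

import Mathlib

open MeasureTheory
open scoped ContDiff

noncomputable section

namespace TwistedBilayer

/-- The plane `ℝ²`; Euclidean lengths are always written out through coordinates below. -/
abbrev Plane : Type := Fin 2 → ℝ

/-- The rotation matrix `R_φ`. -/
def rot (φ : ℝ) : Matrix (Fin 2) (Fin 2) ℝ :=
  !![Real.cos φ, -Real.sin φ; Real.sin φ, Real.cos φ]

/-- `J = R_{-π/2}`. -/
def matJ : Matrix (Fin 2) (Fin 2) ℝ := !![0, 1; -1, 0]

/-- The basis matrix `A₀ = J A` of the reference lattice `𝓡₀ = A₀ ℤ²`. -/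
def refBasis (A : Matrix (Fin 2) (Fin 2) ℝ) : Matrix (Fin 2) (Fin 2) ℝ := matJ * A

/-- The half-open unit cell `B [0,1)²`, a fundamental domain of the torus `ℝ² / Bℤ²`. -/
def cell (B : Matrix (Fin 2) (Fin 2) ℝ) : Set Plane :=
  {x | ∃ s : Plane, (∀ i, 0 ≤ s i ∧ s i < 1) ∧ x = B.mulVec s}

/-- `f` is `Bℤ²`-periodic, i.e. a function on the torus `ℝ² / Bℤ²`. -/
def LatticePeriodic {α : Type*} (B : Matrix (Fin 2) (Fin 2) ℝ) (f : Plane → α) : Prop :=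
  ∀ (k : Fin 2 → ℤ) (x : Plane), f (x + B.mulVec (fun i => (k i : ℝ))) = f x

/-- `g` is the weak partial derivative `∂ⱼ f` on the torus `ℝ² / Bℤ²`: the integration by parts
formula holds against every smooth function on the torus. (Meaningful for `f`, `g` integrable on
the cell, which is the case wherever it is used.) -/
def IsWeakPartial (B : Matrix (Fin 2) (Fin 2) ℝ) (j : Fin 2) (f g : Plane → ℝ) : Prop :=
  ∀ φ : Plane → ℝ, ContDiff ℝ ∞ φ → LatticePeriodic B φ →
    ∫ x in cell B, f x * fderiv ℝ φ x (Pi.single j 1) = -∫ x in cell B, g x * φ x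

/-- A vector field of class `W^{1,2}` on the torus `ℝ² / Bℤ²`: a periodic representative together
with a representative of its weak gradient, `grad x i j = ∂ⱼ uᵢ (x)`, both square integrable on the
cell. (The weak gradient is determined almost everywhere by the field.) -/
structure SobolevField (B : Matrix (Fin 2) (Fin 2) ℝ) where
  toFun : Plane → Plane
  grad : Plane → Matrix (Fin 2) (Fin 2) ℝ
  periodic : LatticePeriodic B toFun
  grad_periodic : LatticePeriodic B grad
  memLp : ∀ i, MemLp (fun x => toFun x i) 2 (volume.restrict (cell B))
  grad_memLp : ∀ i j, MemLp (fun x => grad x i j) 2 (volume.restrict (cell B))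
  weak_grad : ∀ i j, IsWeakPartial B j (fun x => toFun x i) (fun x => grad x i j)

namespace SobolevField

variable {B : Matrix (Fin 2) (Fin 2) ℝ}

/-- `∫ u = 0`; the fields with this property form the space `W^{1,2}_0`. -/
def MeanZero (u : SobolevField B) : Prop := ∀ i, ∫ x in cell B, u.toFun x i = 0

/-- `div u`. -/
def div (u : SobolevField B) (x : Plane) : ℝ := (u.grad x).trace

/-- The linear strain `ε(u) = (∇u + ∇uᵀ) / 2`. -/
def strain (u : SobolevField B) (x : Plane) : Matrix (Fin 2) (Fin 2) ℝ :=
  (1 / 2 : ℝ) • (u.grad x + (u.grad x).transpose)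

/-- `ε(u) : ε(u)`. -/
def strainSq (u : SobolevField B) (x : Plane) : ℝ := ∑ i, ∑ j, (u.strain x i j) ^ 2

/-- The `L²` norm of the gradient. -/
def gradNorm (u : SobolevField B) : ℝ :=
  Real.sqrt (∫ x in cell B, ∑ i, ∑ j, (u.grad x i j) ^ 2)

/-- The full Sobolev norm `‖u‖_{1,2} = (∫ |u|² + |∇u|²)^{1/2}`. -/
def norm12 (u : SobolevField B) : ℝ :=
  Real.sqrt (∫ x in cell B, (∑ i, (u.toFun x i) ^ 2 + ∑ i, ∑ j, (u.grad x i j) ^ 2))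

/-- The elastic energy `𝓔⁰_intra[u] = ∫ (λ/2) (div u)² + μ ε(u) : ε(u)`. -/
def intraEnergy (lam mu : ℝ) (u : SobolevField B) : ℝ :=
  ∫ x in cell B, (lam / 2 * (u.div x) ^ 2 + mu * u.strainSq x)

end SobolevField

/-- The rescaled misfit energy of a displacement field `v` on the cell:
`𝓔^θ_inter[v] = (4 sin²(θ/2))⁻¹ ∫ ½ (Ψ(x - J R_{θ/2} v) + Ψ(x - J R_{-θ/2} v))`. -/
def interEnergy (B : Matrix (Fin 2) (Fin 2) ℝ) (Ψ : Plane → ℝ) (θ : ℝ) (v : Plane → Plane) : ℝ :=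
  1 / (4 * Real.sin (θ / 2) ^ 2) *
    ∫ x in cell B, 1 / 2 * (Ψ (x - (matJ * rot (θ / 2)).mulVec (v x))
      + Ψ (x - (matJ * rot (-(θ / 2))).mulVec (v x)))

/-- The total energy `𝓔^θ₀[u] = 2 𝓔⁰_intra[u] + 𝓔^θ_inter[2u]`. -/
def totalEnergy {B : Matrix (Fin 2) (Fin 2) ℝ} (lam mu : ℝ) (Ψ : Plane → ℝ) (θ : ℝ)
    (u : SobolevField B) : ℝ :=
  2 * u.intraEnergy lam mu + interEnergy B Ψ θ (fun x => (2 : ℝ) • u.toFun x)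

/-- `u` is a minimizer of the total energy in the space of mean-zero `W^{1,2}` fields. -/
def IsMinimizer {B : Matrix (Fin 2) (Fin 2) ℝ} (lam mu : ℝ) (Ψ : Plane → ℝ) (θ : ℝ)
    (u : SobolevField B) : Prop :=
  u.MeanZero ∧ ∀ v : SobolevField B, v.MeanZero →
    totalEnergy lam mu Ψ θ u ≤ totalEnergy lam mu Ψ θ v

/-- `c` is admissible in the Korn-type inequality
`∫ λ (div u)² + 2 μ ε(u) : ε(u) ≥ μ c ‖u‖²_{1,2}` for all mean-zero `W^{1,2}` fields on the torus
`ℝ² / Bℤ²`, for all Lamé parameters. -/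
def KornInequality (B : Matrix (Fin 2) (Fin 2) ℝ) (c : ℝ) : Prop :=
  ∀ lam mu : ℝ, 0 < mu → 0 ≤ lam + mu → ∀ u : SobolevField B, u.MeanZero →
    mu * c * u.norm12 ^ 2 ≤ ∫ x in cell B, (lam * (u.div x) ^ 2 + 2 * mu * u.strainSq x)

end TwistedBilayer

end

open TwistedBilayer

open scoped ComplexConjugate

/-! ### Fourier series and Parseval on a general lattice torus -/

namespace TwistedBilayer

/-! Everything rests on Korn's identity for periodic fields, `elastic_eq`: the elastic form equals
`mu ∫ |∇u|² + (lam + mu) ∫ (div u)²`, because the pointwise discrepancy is a multiple of `det ∇u`,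
which integrates to zero. Since `lam + mu ≥ 0`, the form dominates `mu ∫ |∇u|²`, and Poincaré's
inequality for mean-zero fields turns this into a positive Korn constant
(`kornInequality_of_poincare`). A plane wave bounds the admissible constants from above. For each
fixed field the admissible constants are closed under suprema, so a largest one exists
(`exists_isGreatest_kornInequality`).

The a priori bound compares a minimizer with the zero field: its elastic energy is at most the drop
in misfit energy, hence at most `1 / (4 sin² (θ/2)) ∫ (Ψ - inf Ψ)`, and Korn bounds the norm. The
gradient estimate follows from Jordan's inequality for the sine.

Existence is the direct method with strong rather than weak convergence. Along a minimizing sequence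
the elastic energy is bounded, so Rellich's theorem yields a subsequence that is Cauchy in `L²`. The
misfit energy is Lipschitz in `L²`, so it barely distinguishes two late terms from their midpoint;
the parallelogram law for the elastic form then forces the gradients to be Cauchy as well. The limit
exists by completeness, and both energies pass to it.

Poincaré, Rellich and the vanishing of `∫ det ∇u` are all read off from Parseval, since a weak
derivative multiplies Fourier coefficients by `i` times the wave vector. -/

/-- The normalized Haar measure on the standard two-dimensional torus. -/
noncomputable abbrev torusMeasure : Measure (UnitAddTorus (Fin 2)) :=
  Measure.pi fun _ => AddCircle.haarAddCircle

/-- The measurable section of the covering `ℝ² → ℝ² / Bℤ²` with lattice coordinates in `(0, 1]²`. -/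
noncomputable def torusSection (B : Matrix (Fin 2) (Fin 2) ℝ) (t : UnitAddTorus (Fin 2)) : Plane :=
  B.mulVec (UnitAddTorus.measurableEquivPiIoc 0 t).1

lemma cell_eq_image (B : Matrix (Fin 2) (Fin 2) ℝ) :
    cell B = (Matrix.toLin' B) '' (Set.univ.pi fun _ => Set.Ico (0 : ℝ) 1) := by
  ext x
  simp only [cell, Set.mem_ofPred_eq, Set.mem_image, Set.mem_univ_pi, Set.mem_Ico,
    Matrix.toLin'_apply]
  exact ⟨fun ⟨s, h, e⟩ => ⟨s, h, e.symm⟩, fun ⟨s, h, e⟩ => ⟨s, h, e.symm⟩⟩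

lemma cell_eq_preimage {B : Matrix (Fin 2) (Fin 2) ℝ} (hB : B.det ≠ 0) :
    cell B = (Matrix.toLin' B⁻¹) ⁻¹' (Set.univ.pi fun _ => Set.Ico (0 : ℝ) 1) := by
  have hu : IsUnit B.det := isUnit_iff_ne_zero.mpr hB
  rw [cell_eq_image]
  ext x
  simp only [Set.mem_image, Set.mem_preimage, Matrix.toLin'_apply]
  constructor
  · rintro ⟨s, hs, rfl⟩
    rwa [Matrix.mulVec_mulVec, Matrix.nonsing_inv_mul _ hu, Matrix.one_mulVec]
  · intro h
    exact ⟨_, h, by rw [Matrix.mulVec_mulVec, Matrix.mul_nonsing_inv _ hu, Matrix.one_mulVec]⟩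

lemma measurableSet_cell {B : Matrix (Fin 2) (Fin 2) ℝ} (hB : B.det ≠ 0) :
    MeasurableSet (cell B) := by
  rw [cell_eq_preimage hB]
  exact (LinearMap.continuous_of_finiteDimensional _).measurable
    (MeasurableSet.univ_pi fun _ => measurableSet_Ico)

/-- Turns cell integrals into Haar integrals on the standard torus. The linear map contributes the
factor `|det B|⁻¹`; lattice coordinates in `(0, 1]²` rather than `[0, 1)²` change only a null set.
-/
lemma measurePreserving_torusSection {B : Matrix (Fin 2) (Fin 2) ℝ} (hB : B.det ≠ 0) :
    MeasurePreserving (torusSection B) torusMeasure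
      (ENNReal.ofReal |B.det⁻¹| • volume.restrict (cell B)) := by
  have h1 : MeasurePreserving (UnitAddTorus.measurableEquivPiIoc (0 : Fin 2 → ℝ)) torusMeasure
      (Measure.comap Subtype.val volume) := UnitAddTorus.measurePreserving_equivPiIoc 0
  have hset : {x : Fin 2 → ℝ | ∀ i, x i ∈ Set.Ioc ((0 : Fin 2 → ℝ) i) ((0 : Fin 2 → ℝ) i + 1)}
      = Set.univ.pi fun _ => Set.Ioc (0 : ℝ) 1 := by
    ext x; simp
  have hm : MeasurableSet
      {x : Fin 2 → ℝ | ∀ i, x i ∈ Set.Ioc ((0 : Fin 2 → ℝ) i) ((0 : Fin 2 → ℝ) i + 1)} := by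
    rw [hset]; exact MeasurableSet.univ_pi fun _ => measurableSet_Ioc
  have h2 : MeasurePreserving (Subtype.val :
      {x : Fin 2 → ℝ // ∀ i, x i ∈ Set.Ioc ((0 : Fin 2 → ℝ) i) ((0 : Fin 2 → ℝ) i + 1)} → _)
      (Measure.comap Subtype.val volume)
      (volume.restrict (Set.univ.pi fun _ => Set.Ioc (0 : ℝ) 1)) := by
    rw [← hset]; exact measurePreserving_subtype_coe hm
  have hae : (Set.univ.pi fun _ => Set.Ioc (0 : ℝ) 1 : Set (Fin 2 → ℝ)) =ᵐ[volume]
      (Set.univ.pi fun _ => Set.Ico (0 : ℝ) 1) :=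
    (Measure.univ_pi_Ioc_ae_eq_Icc (μ := fun _ : Fin 2 => (volume : Measure ℝ))
      (f := fun _ => 0) (g := fun _ => 1)).trans
    (Measure.univ_pi_Ico_ae_eq_Icc (μ := fun _ : Fin 2 => (volume : Measure ℝ))
      (f := fun _ => 0) (g := fun _ => 1)).symm
  have hlin : Measurable (Matrix.toLin' B) :=
    (LinearMap.continuous_of_finiteDimensional _).measurable
  have h3 : MeasurePreserving (Matrix.toLin' B)
      (volume.restrict (Set.univ.pi fun _ => Set.Ioc (0 : ℝ) 1))
      (ENNReal.ofReal |B.det⁻¹| • volume.restrict (cell B)) := by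
    refine ⟨hlin, ?_⟩
    rw [Measure.restrict_congr_set hae, ← Measure.restrict_smul,
      ← Real.map_matrix_volume_pi_eq_smul_volume_pi hB,
      Measure.restrict_map hlin (measurableSet_cell hB), cell_eq_image,
      Set.preimage_image_eq]
    intro x y hxy
    simp only [Matrix.toLin'_apply] at hxy
    exact Matrix.mulVec_injective_of_isUnit
      ((Matrix.isUnit_iff_isUnit_det _).mpr (isUnit_iff_ne_zero.mpr hB)) hxy
  exact h3.comp (h2.comp h1)

instance isFiniteMeasure_restrict_cell (B : Matrix (Fin 2) (Fin 2) ℝ) :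
    IsFiniteMeasure (volume.restrict (cell B)) := by
  refine ⟨?_⟩
  rw [Measure.restrict_apply_univ, cell_eq_image]
  have hc : IsCompact ((Matrix.toLin' B) '' (Set.univ.pi fun _ => Set.Icc (0 : ℝ) 1)) :=
    (isCompact_univ_pi fun _ => isCompact_Icc).image (LinearMap.continuous_of_finiteDimensional _)
  exact (measure_mono (Set.image_mono (Set.pi_mono fun _ _ => Set.Ico_subset_Icc_self))).trans_lt
    hc.measure_lt_top

lemma integral_torusSection {B : Matrix (Fin 2) (Fin 2) ℝ} (hB : B.det ≠ 0)
    {E : Type*} [NormedAddCommGroup E] [NormedSpace ℝ E] {F : Plane → E}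
    (hF : AEStronglyMeasurable F (volume.restrict (cell B))) :
    ∫ t, F (torusSection B t) ∂torusMeasure = |B.det|⁻¹ • ∫ x in cell B, F x := by
  have hp := measurePreserving_torusSection hB
  have h := integral_map hp.measurable.aemeasurable (f := F)
    (by rw [hp.map_eq]; exact hF.smul_measure _)
  rw [← h, hp.map_eq, integral_smul_measure, ENNReal.toReal_ofReal (abs_nonneg _), abs_inv]

/-- The phase `2π n · B⁻¹ x` of the `n`-th character of `ℝ² / Bℤ²`. -/
noncomputable def phase (B : Matrix (Fin 2) (Fin 2) ℝ) (n : Fin 2 → ℤ) (x : Plane) : ℝ :=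
  2 * Real.pi * ∑ i, (n i : ℝ) * (B⁻¹.mulVec x) i

/-- The Fourier coefficients of a function on the torus `ℝ² / Bℤ²`. -/
noncomputable def latticeFourierCoeff (B : Matrix (Fin 2) (Fin 2) ℝ) (f : Plane → ℝ)
    (n : Fin 2 → ℤ) : ℂ :=
  UnitAddTorus.mFourierCoeff (fun t => (f (torusSection B t) : ℂ)) n

lemma coe_measurableEquivPiIoc_fst (t : UnitAddTorus (Fin 2)) (i : Fin 2) :
    (((UnitAddTorus.measurableEquivPiIoc (0 : Fin 2 → ℝ) t).1 i : ℝ) : UnitAddCircle) = t i := by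
  have := congrFun ((UnitAddTorus.measurableEquivPiIoc (0 : Fin 2 → ℝ)).symm_apply_apply t) i
  rwa [UnitAddTorus.coe_symm_measurableEquivPiIoc_apply] at this

lemma inv_mulVec_torusSection {B : Matrix (Fin 2) (Fin 2) ℝ} (hB : B.det ≠ 0)
    (t : UnitAddTorus (Fin 2)) :
    B⁻¹.mulVec (torusSection B t) = (UnitAddTorus.measurableEquivPiIoc (0 : Fin 2 → ℝ) t).1 := by
  rw [torusSection, Matrix.mulVec_mulVec, Matrix.nonsing_inv_mul _ (isUnit_iff_ne_zero.mpr hB),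
    Matrix.one_mulVec]

lemma mFourier_neg_eq_exp_phase {B : Matrix (Fin 2) (Fin 2) ℝ} (hB : B.det ≠ 0)
    (n : Fin 2 → ℤ) (t : UnitAddTorus (Fin 2)) :
    UnitAddTorus.mFourier (-n) t
      = Complex.exp (-(phase B n (torusSection B t)) * Complex.I) := by
  have : UnitAddTorus.mFourier (-n) t = ∏ i, fourier (-n i) (t i) := rfl
  rw [this, phase, inv_mulVec_torusSection hB]
  conv_lhs =>
    enter [2, i]
    rw [← coe_measurableEquivPiIoc_fst t i, fourier_coe_apply]
  rw [← Complex.exp_sum]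
  congr 1
  simp only [Fin.sum_univ_two]
  push_cast
  ring

lemma continuous_phase (B : Matrix (Fin 2) (Fin 2) ℝ) (n : Fin 2 → ℤ) :
    Continuous (phase B n) := by
  unfold phase Matrix.mulVec dotProduct
  fun_prop

/-- The real cosine and sine integrals are the form to which weak derivatives, defined with real
test functions, apply. -/
lemma latticeFourierCoeff_eq {B : Matrix (Fin 2) (Fin 2) ℝ} (hB : B.det ≠ 0) {f : Plane → ℝ}
    (hf : Integrable f (volume.restrict (cell B))) (n : Fin 2 → ℤ) :
    latticeFourierCoeff B f n = |B.det|⁻¹ *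
      ((∫ x in cell B, f x * Real.cos (phase B n x) : ℝ)
        - (∫ x in cell B, f x * Real.sin (phase B n x) : ℝ) * Complex.I) := by
  have hph := continuous_phase B n
  have h1 : latticeFourierCoeff B f n
      = ∫ t, (fun x => Complex.exp (-(phase B n x) * Complex.I) * (f x : ℂ)) (torusSection B t)
        ∂torusMeasure := by
    refine integral_congr_ae (Filter.Eventually.of_forall fun t => ?_)
    simp only [mFourier_neg_eq_exp_phase hB, smul_eq_mul]
  rw [h1, integral_torusSection hB
    (F := fun x => Complex.exp (-(phase B n x) * Complex.I) * (f x : ℂ))]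
  · have hc : Integrable (fun x => f x * Real.cos (phase B n x)) (volume.restrict (cell B)) :=
      hf.mul_bdd (c := 1) (by fun_prop)
        (Filter.Eventually.of_forall fun x => Real.abs_cos_le_one _)
    have hs : Integrable (fun x => f x * Real.sin (phase B n x)) (volume.restrict (cell B)) :=
      hf.mul_bdd (c := 1) (by fun_prop)
        (Filter.Eventually.of_forall fun x => Real.abs_sin_le_one _)
    rw [← integral_complex_ofReal, ← integral_complex_ofReal, ← integral_mul_const,
      ← integral_sub hc.ofReal (hs.ofReal.mul_const _), Complex.real_smul, Complex.ofReal_inv]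
    congr 1
    refine integral_congr_ae (Filter.Eventually.of_forall fun x => ?_)
    simp only [Complex.exp_mul_I, Complex.cos_neg, Complex.sin_neg]
    push_cast
    ring
  · exact AEStronglyMeasurable.mul (Continuous.aestronglyMeasurable (by fun_prop))
      (Complex.continuous_ofReal.comp_aestronglyMeasurable hf.1)

/-- **Parseval's identity** on the torus `ℝ² / Bℤ²`. -/
lemma hasSum_latticeFourierCoeff {B : Matrix (Fin 2) (Fin 2) ℝ} (hB : B.det ≠ 0) {f g : Plane → ℝ}
    (hf : MemLp f 2 (volume.restrict (cell B))) (hg : MemLp g 2 (volume.restrict (cell B))) :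
    HasSum (fun n => conj (latticeFourierCoeff B f n) * latticeFourierCoeff B g n)
      ((|B.det|⁻¹ * ∫ x in cell B, f x * g x : ℝ) : ℂ) := by
  have key : ∀ {f : Plane → ℝ}, MemLp f 2 (volume.restrict (cell B)) →
      MemLp (fun t => (f (torusSection B t) : ℂ)) 2 torusMeasure := fun {f} hf =>
    ((hf.smul_measure ENNReal.ofReal_ne_top).comp_measurePreserving
      (measurePreserving_torusSection hB)).ofReal
  have hc : ∀ {f : Plane → ℝ} (hf : MemLp f 2 (volume.restrict (cell B))) (n : Fin 2 → ℤ),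
      UnitAddTorus.mFourierCoeff ((key hf).toLp _) n = latticeFourierCoeff B f n := by
    intro f hf n
    refine integral_congr_ae ?_
    filter_upwards [(key hf).coeFn_toLp] with t ht
    rw [ht]
  have h := UnitAddTorus.hasSum_prod_mFourierCoeff ((key hf).toLp _) ((key hg).toLp _)
  convert h using 1
  · funext n
    rw [← hc hf n, ← hc hg n]
  have h2 := integral_torusSection hB (F := fun x => f x * g x) (hf.1.mul hg.1)
  rw [smul_eq_mul] at h2
  rw [← h2, ← integral_complex_ofReal]
  refine integral_congr_ae ?_
  filter_upwards [(key hf).coeFn_toLp, (key hg).coeFn_toLp] with t h1 h2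
  rw [h1, h2, Complex.conj_ofReal, Complex.ofReal_mul]

lemma hasSum_sq_norm_latticeFourierCoeff {B : Matrix (Fin 2) (Fin 2) ℝ} (hB : B.det ≠ 0)
    {f : Plane → ℝ} (hf : MemLp f 2 (volume.restrict (cell B))) :
    HasSum (fun n => ‖latticeFourierCoeff B f n‖ ^ 2) (|B.det|⁻¹ * ∫ x in cell B, f x ^ 2) := by
  have h := hasSum_latticeFourierCoeff hB hf hf
  rw [← Complex.hasSum_ofReal]
  simpa only [Complex.conj_mul', ← sq, ← Complex.ofReal_pow] using h

/-- On the torus, translation by `v` is translation by the class of `B⁻¹ v`, which preserves Haar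
measure. -/
lemma integral_cell_add {B : Matrix (Fin 2) (Fin 2) ℝ} (hB : B.det ≠ 0) {h : Plane → ℝ}
    (hc : Continuous h) (hp : LatticePeriodic B h) (v : Plane) :
    ∫ x in cell B, h (x + v) = ∫ x in cell B, h x := by
  have hu : IsUnit B.det := isUnit_iff_ne_zero.mpr hB
  have e1 := integral_torusSection hB (F := h) hc.aestronglyMeasurable
  have e2 := integral_torusSection hB (F := fun x => h (x + v))
    (Continuous.aestronglyMeasurable (by fun_prop))
  -- Both arguments lie over the same torus point, so they differ by a lattice vector and
  -- periodicity identifies the values.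
  have key : ∀ t, h (torusSection B t + v)
      = h (torusSection B (t + fun i => ((B⁻¹.mulVec v i : ℝ) : UnitAddCircle))) := by
    intro t
    set t' := t + fun i => ((B⁻¹.mulVec v i : ℝ) : UnitAddCircle) with ht'
    have : ∀ i, ∃ k : ℤ, B⁻¹.mulVec (torusSection B t + v) i
        = B⁻¹.mulVec (torusSection B t') i + k := by
      intro i
      have : ((B⁻¹.mulVec (torusSection B t + v) i : ℝ) : UnitAddCircle)
          = (B⁻¹.mulVec (torusSection B t') i : ℝ) := by
        rw [Matrix.mulVec_add, inv_mulVec_torusSection hB, inv_mulVec_torusSection hB,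
          coe_measurableEquivPiIoc_fst, Pi.add_apply, AddCircle.coe_add,
          coe_measurableEquivPiIoc_fst, ht', Pi.add_apply]
      rw [← sub_eq_zero, ← AddCircle.coe_sub, AddCircle.coe_eq_zero_iff] at this
      obtain ⟨k, hk⟩ := this
      refine ⟨k, ?_⟩
      rw [zsmul_eq_mul, mul_one] at hk
      linarith
    choose k hk using this
    rw [← hp k (torusSection B t')]
    congr 1
    have : B⁻¹.mulVec (torusSection B t + v) = B⁻¹.mulVec (torusSection B t') + fun i => (k i : ℝ) :=
      funext hk
    have := congrArg B.mulVec this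
    rwa [Matrix.mulVec_add B, Matrix.mulVec_mulVec, Matrix.mulVec_mulVec,
      Matrix.mul_nonsing_inv _ hu, Matrix.one_mulVec, Matrix.one_mulVec] at this
  simp only [key] at e2
  rw [integral_add_right_eq_self (μ := torusMeasure) (fun t => h (torusSection B t)), e1] at e2
  exact (smul_right_injective ℝ (inv_ne_zero (abs_ne_zero.mpr hB)) e2).symm

end TwistedBilayer

/-! ### Weak derivatives in Fourier space: Poincaré, Rellich, null Lagrangian -/

namespace TwistedBilayer

open Filter Topology

/-- The `j`-th coordinate of the wave vector `2π B⁻ᵀ n`. -/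
noncomputable def waveVector (B : Matrix (Fin 2) (Fin 2) ℝ) (n : Fin 2 → ℤ) (j : Fin 2) : ℝ :=
  2 * Real.pi * ∑ i, (n i : ℝ) * B⁻¹ i j

lemma hasFDerivAt_phase (B : Matrix (Fin 2) (Fin 2) ℝ) (n : Fin 2 → ℤ) (x : Plane) :
    HasFDerivAt (phase B n)
      (∑ j, waveVector B n j • (ContinuousLinearMap.proj j : Plane →L[ℝ] ℝ)) x := by
  have : phase B n = (∑ j, waveVector B n j • (ContinuousLinearMap.proj j : Plane →L[ℝ] ℝ) :
      Plane →L[ℝ] ℝ) := by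
    funext y
    simp [phase, waveVector, Matrix.mulVec, dotProduct, Fin.sum_univ_two]
    ring
  rw [this]
  exact ContinuousLinearMap.hasFDerivAt _

lemma contDiff_phase (B : Matrix (Fin 2) (Fin 2) ℝ) (n : Fin 2 → ℤ) : ContDiff ℝ ∞ (phase B n) := by
  unfold phase Matrix.mulVec dotProduct
  fun_prop

lemma phase_add_lattice {B : Matrix (Fin 2) (Fin 2) ℝ} (hB : B.det ≠ 0) (n k : Fin 2 → ℤ)
    (x : Plane) :
    phase B n (x + B.mulVec (fun i => (k i : ℝ)))
      = phase B n x + (∑ i, n i * k i : ℤ) * (2 * Real.pi) := by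
  rw [phase, Matrix.mulVec_add, Matrix.mulVec_mulVec,
    Matrix.nonsing_inv_mul _ (isUnit_iff_ne_zero.mpr hB), Matrix.one_mulVec, phase]
  simp only [Pi.add_apply, Fin.sum_univ_two]
  push_cast
  ring

lemma latticePeriodic_cos_phase {B : Matrix (Fin 2) (Fin 2) ℝ} (hB : B.det ≠ 0) (n : Fin 2 → ℤ) :
    LatticePeriodic B (fun x => Real.cos (phase B n x)) := fun k x => by
  simp only [phase_add_lattice hB, Real.cos_add_int_mul_two_pi]

lemma latticePeriodic_sin_phase {B : Matrix (Fin 2) (Fin 2) ℝ} (hB : B.det ≠ 0) (n : Fin 2 → ℤ) :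
    LatticePeriodic B (fun x => Real.sin (phase B n x)) := fun k x => by
  simp only [phase_add_lattice hB, Real.sin_add_int_mul_two_pi]

lemma fderiv_cos_phase (B : Matrix (Fin 2) (Fin 2) ℝ) (n : Fin 2 → ℤ) (j : Fin 2) (x : Plane) :
    fderiv ℝ (fun x => Real.cos (phase B n x)) x (Pi.single j 1)
      = -(waveVector B n j * Real.sin (phase B n x)) := by
  rw [(hasFDerivAt_phase B n x).cos.fderiv]
  fin_cases j <;> simp [mul_comm]

lemma fderiv_sin_phase (B : Matrix (Fin 2) (Fin 2) ℝ) (n : Fin 2 → ℤ) (j : Fin 2) (x : Plane) :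
    fderiv ℝ (fun x => Real.sin (phase B n x)) x (Pi.single j 1)
      = waveVector B n j * Real.cos (phase B n x) := by
  rw [(hasFDerivAt_phase B n x).sin.fderiv]
  fin_cases j <;> simp [mul_comm]

/-- Weak differentiation acts on Fourier coefficients as multiplication by `i` times the wave
vector. -/
lemma IsWeakPartial.latticeFourierCoeff {B : Matrix (Fin 2) (Fin 2) ℝ} (hB : B.det ≠ 0)
    {f g : Plane → ℝ} {j : Fin 2} (h : IsWeakPartial B j f g)
    (hf : Integrable f (volume.restrict (cell B))) (hg : Integrable g (volume.restrict (cell B)))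
    (n : Fin 2 → ℤ) :
    TwistedBilayer.latticeFourierCoeff B g n
      = waveVector B n j * Complex.I * TwistedBilayer.latticeFourierCoeff B f n := by
  rw [latticeFourierCoeff_eq hB hf, latticeFourierCoeff_eq hB hg]
  have hc := h _ (Real.contDiff_cos.comp (contDiff_phase B n)) (latticePeriodic_cos_phase hB n)
  have hs := h _ (Real.contDiff_sin.comp (contDiff_phase B n)) (latticePeriodic_sin_phase hB n)
  simp only [Function.comp_def, fderiv_cos_phase] at hc
  simp only [Function.comp_def, fderiv_sin_phase] at hs
  have e1 : ∫ x in cell B, g x * Real.cos (phase B n x)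
      = waveVector B n j * ∫ x in cell B, f x * Real.sin (phase B n x) := by
    rw [← neg_neg (∫ x in cell B, g x * Real.cos (phase B n x)), ← hc, ← integral_const_mul,
      ← integral_neg]
    congr 1; funext x; ring
  have e2 : ∫ x in cell B, g x * Real.sin (phase B n x)
      = -(waveVector B n j * ∫ x in cell B, f x * Real.cos (phase B n x)) := by
    rw [← integral_const_mul, eq_comm, neg_eq_iff_eq_neg, ← hs]
    congr 1; funext x; ring
  rw [e1, e2]
  push_cast
  linear_combination ((|B.det| : ℝ) : ℂ)⁻¹ * waveVector B n j *
    (∫ x in cell B, f x * Real.sin (phase B n x) : ℝ) * Complex.I_sq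

lemma two_pi_mul_eq_sum_waveVector {B : Matrix (Fin 2) (Fin 2) ℝ} (hB : B.det ≠ 0)
    (n : Fin 2 → ℤ) (i : Fin 2) : 2 * Real.pi * n i = ∑ j, waveVector B n j * B j i := by
  have h := Matrix.nonsing_inv_mul B (isUnit_iff_ne_zero.mpr hB)
  have h2 : ∀ l, ∑ j, B⁻¹ l j * B j i = if l = i then 1 else 0 := fun l => by
    rw [← Matrix.mul_apply, h, Matrix.one_apply]
  calc 2 * Real.pi * n i = 2 * Real.pi * ∑ l, (n l : ℝ) * ∑ j, B⁻¹ l j * B j i := by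
        simp [h2]
    _ = _ := by simp only [waveVector, Fin.sum_univ_two]; ring

/-- The frequency `n` is controlled by the wave vector `2π B⁻ᵀ n`. -/
lemma sum_sq_le_waveVector {B : Matrix (Fin 2) (Fin 2) ℝ} (hB : B.det ≠ 0) (n : Fin 2 → ℤ) :
    ∑ i, (n i : ℝ) ^ 2 ≤ (∑ i, ∑ j, B i j ^ 2) * ∑ j, waveVector B n j ^ 2 := by
  have h : ∀ i, (2 * Real.pi * n i) ^ 2 ≤ (∑ j, waveVector B n j ^ 2) * ∑ j, B j i ^ 2 := fun i => by
    rw [two_pi_mul_eq_sum_waveVector hB]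
    exact Finset.sum_mul_sq_le_sq_mul_sq _ _ _
  -- The factor `(2π)²` is simply discarded; no sharp constant is needed.
  have h1 : ∀ i, (n i : ℝ) ^ 2 ≤ (2 * Real.pi * n i) ^ 2 := fun i => by
    rw [mul_pow]
    have : 1 ≤ (2 * Real.pi) ^ 2 := one_le_pow₀ (by linarith [Real.pi_gt_three])
    nlinarith [sq_nonneg (n i : ℝ)]
  rw [Finset.sum_comm, mul_comm, Finset.mul_sum]
  exact Finset.sum_le_sum fun i _ => (h1 i).trans (h i)

section WeakGradient

variable {B : Matrix (Fin 2) (Fin 2) ℝ} {f : Plane → ℝ} {g : Fin 2 → Plane → ℝ}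

/-- The frequency-side estimate behind both Poincaré (weight at least 1 off zero) and Rellich
(weight tending to infinity). -/
lemma norm_sq_latticeFourierCoeff_le (hB : B.det ≠ 0)
    (hf : MemLp f 2 (volume.restrict (cell B)))
    (hg : ∀ j, MemLp (g j) 2 (volume.restrict (cell B)))
    (h : ∀ j, IsWeakPartial B j f (g j)) (n : Fin 2 → ℤ) :
    (∑ i, (n i : ℝ) ^ 2) * ‖latticeFourierCoeff B f n‖ ^ 2
      ≤ (∑ i, ∑ j, B i j ^ 2) * ∑ j, ‖latticeFourierCoeff B (g j) n‖ ^ 2 := by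
  have e : ∀ j, ‖latticeFourierCoeff B (g j) n‖ ^ 2
      = waveVector B n j ^ 2 * ‖latticeFourierCoeff B f n‖ ^ 2 := fun j => by
    rw [(h j).latticeFourierCoeff hB (hf.integrable one_le_two) ((hg j).integrable one_le_two),
      norm_mul, norm_mul, Complex.norm_I, Complex.norm_real, mul_one, mul_pow, Real.norm_eq_abs,
      sq_abs]
  simp only [e, ← Finset.sum_mul]
  rw [← mul_assoc]
  exact mul_le_mul_of_nonneg_right (sum_sq_le_waveVector hB n) (sq_nonneg _)

lemma hasSum_sum_sq_norm_latticeFourierCoeff (hB : B.det ≠ 0)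
    (hg : ∀ j, MemLp (g j) 2 (volume.restrict (cell B))) :
    HasSum (fun n => (∑ i, ∑ j, B i j ^ 2) * ∑ j, ‖latticeFourierCoeff B (g j) n‖ ^ 2)
      ((∑ i, ∑ j, B i j ^ 2) * ∑ j, |B.det|⁻¹ * ∫ x in cell B, g j x ^ 2) :=
  (hasSum_sum fun j _ => hasSum_sq_norm_latticeFourierCoeff hB (hg j)).mul_left _

/-- **Poincaré's inequality** on the torus `ℝ² / Bℤ²`. -/
lemma integral_sq_le_of_integral_eq_zero (hB : B.det ≠ 0)
    (hf : MemLp f 2 (volume.restrict (cell B)))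
    (hg : ∀ j, MemLp (g j) 2 (volume.restrict (cell B)))
    (h : ∀ j, IsWeakPartial B j f (g j)) (h0 : ∫ x in cell B, f x = 0) :
    ∫ x in cell B, f x ^ 2 ≤ (∑ i, ∑ j, B i j ^ 2) * ∑ j, ∫ x in cell B, g j x ^ 2 := by
  have hdet : 0 < |B.det|⁻¹ := inv_pos.mpr (abs_pos.mpr hB)
  have key := hasSum_le (fun n => ?_) (hasSum_sq_norm_latticeFourierCoeff hB hf)
    (hasSum_sum_sq_norm_latticeFourierCoeff hB hg)
  · rw [← Finset.mul_sum, mul_left_comm] at key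
    exact le_of_mul_le_mul_left key hdet
  -- The zeroth coefficient is the mean, which vanishes; any other integer frequency has squared
  -- length at least 1.
  by_cases hn : n = 0
  · have : latticeFourierCoeff B f n = 0 := by
      rw [latticeFourierCoeff_eq hB (hf.integrable one_le_two), hn]
      simp [phase, h0]
    rw [this, norm_zero, zero_pow two_ne_zero]
    positivity
  · refine le_trans ?_ (norm_sq_latticeFourierCoeff_le hB hf hg h n)
    refine le_mul_of_one_le_left (sq_nonneg _) ?_
    obtain ⟨i, hi⟩ := Function.ne_iff.mp hn
    refine le_trans ?_ (Finset.single_le_sum (fun i _ => sq_nonneg (n i : ℝ)) (Finset.mem_univ i))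
    have : (1 : ℤ) ≤ n i ^ 2 := Int.add_one_le_of_lt (sq_pos_of_ne_zero hi)
    exact_mod_cast this

end WeakGradient

/-- A family of sequences that is bounded in a weighted `ℓ²` space, with weights tending to
infinity, is relatively compact in `ℓ²`. -/
lemma exists_subseq_sum_sq_sub_le {ι : Type*} [Countable ι] {w : ι → ℝ} (hw1 : ∀ i, 1 ≤ w i)
    (hw : ∀ C, {i | w i ≤ C}.Finite) {a : ℕ → ι → ℂ} {M : ℝ}
    (ha : ∀ k (s : Finset ι), ∑ i ∈ s, w i * ‖a k i‖ ^ 2 ≤ M) :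
    ∃ φ : ℕ → ℕ, StrictMono φ ∧ ∀ ε > 0, ∃ N, ∀ m ≥ N, ∀ n ≥ N, ∀ s : Finset ι,
      ∑ i ∈ s, ‖a (φ m) i - a (φ n) i‖ ^ 2 ≤ ε := by
  have hM : 0 ≤ M := by simpa using ha 0 ∅
  have hb : ∀ k i, ‖a k i‖ ≤ Real.sqrt M := fun k i => by
    refine Real.le_sqrt_of_sq_le ?_
    have := ha k {i}
    rw [Finset.sum_singleton] at this
    nlinarith [hw1 i, sq_nonneg ‖a k i‖]
  -- The weights are at least 1, so every coordinate lies in one fixed disc. Tychonoff gives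
  -- coordinatewise convergence; it remains to control the tails uniformly.
  obtain ⟨b, -, φ, hφ, hlim⟩ := (isCompact_univ_pi fun _ : ι =>
    isCompact_closedBall (0 : ℂ) (Real.sqrt M)).tendsto_subseq
    (x := a) (fun k i _ => by simpa using hb k i)
  refine ⟨φ, hφ, fun ε hε => ?_⟩
  -- Where `w > C`, the bound `‖a - b‖² ≤ 2‖a‖² + 2‖b‖²` makes `C` times the tail at most `4 * M`,
  -- and `C * (ε / 2) = 4 * M + ε / 2`. The `+ 1` keeps `C` positive when `M = 0`.
  set C : ℝ := 8 * M / ε + 1 with hC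
  have hC0 : 0 < C := by positivity
  set T := (hw C).toFinset with hT
  have hcau : Tendsto (fun p : ℕ × ℕ => ∑ i ∈ T, ‖a (φ p.1) i - a (φ p.2) i‖ ^ 2)
      (atTop ×ˢ atTop) (𝓝 0) := by
    have h1 : ∀ i, Tendsto (fun k => a (φ k) i) atTop (𝓝 (b i)) := fun i =>
      (tendsto_pi_nhds.mp hlim) i
    have h2 : ∀ i ∈ T, Tendsto (fun p : ℕ × ℕ => ‖a (φ p.1) i - a (φ p.2) i‖ ^ 2)
        (atTop ×ˢ atTop) (𝓝 0) := fun i _ => by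
      have := ((((h1 i).comp tendsto_fst).sub ((h1 i).comp tendsto_snd)).norm.pow 2 :
        Tendsto _ (atTop ×ˢ atTop : Filter (ℕ × ℕ)) _)
      simpa using this
    simpa using tendsto_finsetSum T h2
  have hev := hcau.eventually (gt_mem_nhds (half_pos hε))
  rw [prod_atTop_atTop_eq, eventually_atTop] at hev
  obtain ⟨⟨N1, N2⟩, hN⟩ := hev
  refine ⟨max N1 N2, fun m hm n hn s => ?_⟩
  have h1 := hN (m, n) ⟨le_trans (le_max_left _ _) hm, le_trans (le_max_right _ _) hn⟩
  classical
  have h2 : ∑ i ∈ s with i ∉ T, ‖a (φ m) i - a (φ n) i‖ ^ 2 ≤ ε / 2 := by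
    have h3 : ∀ i ∈ s.filter (· ∉ T), C * ‖a (φ m) i - a (φ n) i‖ ^ 2
        ≤ 2 * (w i * ‖a (φ m) i‖ ^ 2) + 2 * (w i * ‖a (φ n) i‖ ^ 2) := fun i hi => by
      have hi2 : C < w i := by simpa [hT] using (Finset.mem_filter.mp hi).2
      have h4 : ‖a (φ m) i - a (φ n) i‖ ^ 2 ≤ 2 * ‖a (φ m) i‖ ^ 2 + 2 * ‖a (φ n) i‖ ^ 2 := by
        have := norm_sub_le (a (φ m) i) (a (φ n) i)
        nlinarith [sq_nonneg (‖a (φ m) i‖ - ‖a (φ n) i‖), norm_nonneg (a (φ m) i - a (φ n) i)]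
      calc _ ≤ w i * ‖a (φ m) i - a (φ n) i‖ ^ 2 :=
            mul_le_mul_of_nonneg_right hi2.le (sq_nonneg _)
        _ ≤ w i * (2 * ‖a (φ m) i‖ ^ 2 + 2 * ‖a (φ n) i‖ ^ 2) :=
            mul_le_mul_of_nonneg_left h4 (by linarith)
        _ = _ := by ring
    have h5 := Finset.sum_le_sum h3
    rw [← Finset.mul_sum, Finset.sum_add_distrib, ← Finset.mul_sum, ← Finset.mul_sum] at h5
    have h6 := ha (φ m) (s.filter (· ∉ T))
    have h7 := ha (φ n) (s.filter (· ∉ T))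
    have h8 : C * ∑ i ∈ s with i ∉ T, ‖a (φ m) i - a (φ n) i‖ ^ 2 ≤ C * (ε / 2) := by
      have : C * (ε / 2) = 4 * M + ε / 2 := by rw [hC]; field_simp; ring
      linarith
    exact le_of_mul_le_mul_left h8 hC0
  rw [← Finset.sum_filter_add_sum_filter_not s (· ∈ T)]
  have h9 : ∑ i ∈ s with i ∈ T, ‖a (φ m) i - a (φ n) i‖ ^ 2
      ≤ ∑ i ∈ T, ‖a (φ m) i - a (φ n) i‖ ^ 2 :=
    Finset.sum_le_sum_of_subset_of_nonneg (fun i hi => (Finset.mem_filter.mp hi).2)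
      fun i _ _ => sq_nonneg _
  linarith

lemma finite_sum_sq_le (C : ℝ) : {n : Fin 2 → ℤ | 1 + ∑ i, (n i : ℝ) ^ 2 ≤ C}.Finite := by
  refine (Set.Finite.pi (t := fun _ : Fin 2 => Set.Icc (-⌈C⌉) ⌈C⌉)
    fun _ => Set.finite_Icc _ _).subset fun n hn i _ => ?_
  have h1 := Finset.single_le_sum (fun i _ => sq_nonneg (n i : ℝ)) (Finset.mem_univ i)
  have h2 : (1 : ℝ) + n i ^ 2 ≤ C := le_trans (by simpa using h1) hn
  have h3 : |n i| ≤ ⌈C⌉ := by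
    have : ((|n i| : ℤ) : ℝ) ≤ ⌈C⌉ := by
      refine le_trans ?_ (Int.le_ceil C)
      push_cast
      nlinarith [sq_nonneg (|(n i : ℝ)| - 1), sq_abs (n i : ℝ), abs_nonneg (n i : ℝ)]
    exact_mod_cast this
  exact abs_le.mp h3

lemma latticeFourierCoeff_sub {B : Matrix (Fin 2) (Fin 2) ℝ} (hB : B.det ≠ 0) {f g : Plane → ℝ}
    (hf : Integrable f (volume.restrict (cell B))) (hg : Integrable g (volume.restrict (cell B)))
    (n : Fin 2 → ℤ) :
    latticeFourierCoeff B (fun x => f x - g x) n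
      = latticeFourierCoeff B f n - latticeFourierCoeff B g n := by
  have hph := continuous_phase B n
  rw [latticeFourierCoeff_eq hB hf, latticeFourierCoeff_eq hB hg,
    latticeFourierCoeff_eq hB (f := fun x => f x - g x) (hf.sub hg)]
  have hc : ∀ {f : Plane → ℝ}, Integrable f (volume.restrict (cell B)) →
      Integrable (fun x => f x * Real.cos (phase B n x)) (volume.restrict (cell B)) := fun hf =>
    hf.mul_bdd (c := 1) (by fun_prop) (Eventually.of_forall fun x => Real.abs_cos_le_one _)
  have hs : ∀ {f : Plane → ℝ}, Integrable f (volume.restrict (cell B)) →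
      Integrable (fun x => f x * Real.sin (phase B n x)) (volume.restrict (cell B)) := fun hf =>
    hf.mul_bdd (c := 1) (by fun_prop) (Eventually.of_forall fun x => Real.abs_sin_le_one _)
  simp only [sub_mul]
  rw [integral_sub (hc hf) (hc hg), integral_sub (hs hf) (hs hg)]
  push_cast
  ring

/-- **Rellich's theorem** on the torus `ℝ² / Bℤ²`. -/
lemma exists_subseq_integral_sq_sub_le {B : Matrix (Fin 2) (Fin 2) ℝ} (hB : B.det ≠ 0)
    {f : ℕ → Plane → ℝ} {g : ℕ → Fin 2 → Plane → ℝ}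
    (hf : ∀ k, MemLp (f k) 2 (volume.restrict (cell B)))
    (hg : ∀ k j, MemLp (g k j) 2 (volume.restrict (cell B)))
    (h : ∀ k j, IsWeakPartial B j (f k) (g k j)) {M : ℝ}
    (hfM : ∀ k, ∫ x in cell B, f k x ^ 2 ≤ M) (hgM : ∀ k j, ∫ x in cell B, g k j x ^ 2 ≤ M) :
    ∃ φ : ℕ → ℕ, StrictMono φ ∧ ∀ ε > 0, ∃ N, ∀ m ≥ N, ∀ n ≥ N,
      ∫ x in cell B, (f (φ m) x - f (φ n) x) ^ 2 ≤ ε := by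
  have hdet : 0 < |B.det|⁻¹ := inv_pos.mpr (abs_pos.mpr hB)
  have hS : 0 ≤ ∑ i, ∑ j, B i j ^ 2 := by positivity
  obtain ⟨φ, hφ, hφ2⟩ := exists_subseq_sum_sq_sub_le
    (w := fun n : Fin 2 → ℤ => 1 + ∑ i, (n i : ℝ) ^ 2)
    (a := fun k => latticeFourierCoeff B (f k))
    (M := |B.det|⁻¹ * M + (∑ i, ∑ j, B i j ^ 2) * (2 * (|B.det|⁻¹ * M)))
    (fun n => le_add_of_nonneg_right (by positivity)) finite_sum_sq_le fun k s => by
      have hsum := (hasSum_sq_norm_latticeFourierCoeff hB (hf k)).add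
        (hasSum_sum_sq_norm_latticeFourierCoeff hB (hg k))
      calc _ ≤ ∑ n ∈ s, (‖latticeFourierCoeff B (f k) n‖ ^ 2
            + (∑ i, ∑ j, B i j ^ 2) * ∑ j, ‖latticeFourierCoeff B (g k j) n‖ ^ 2) :=
            Finset.sum_le_sum fun n _ => by
              rw [add_mul, one_mul]
              exact add_le_add le_rfl (norm_sq_latticeFourierCoeff_le hB (hf k) (hg k) (h k) n)
        _ ≤ _ := sum_le_hasSum s (fun n _ => by positivity) hsum
        _ ≤ _ := by
          refine add_le_add (mul_le_mul_of_nonneg_left (hfM k) hdet.le)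
            (mul_le_mul_of_nonneg_left ?_ hS)
          rw [Fin.sum_univ_two, two_mul]
          exact add_le_add (mul_le_mul_of_nonneg_left (hgM k 0) hdet.le)
            (mul_le_mul_of_nonneg_left (hgM k 1) hdet.le)
  refine ⟨φ, hφ, fun ε hε => ?_⟩
  obtain ⟨N, hN⟩ := hφ2 (|B.det|⁻¹ * ε) (by positivity)
  refine ⟨N, fun m hm n hn => ?_⟩
  have hsum := hasSum_sq_norm_latticeFourierCoeff hB ((hf (φ m)).sub (hf (φ n)))
  -- Parseval for the difference converts the uniform bound on finite partial sums into a bound on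
  -- the integral.
  have := hasSum_le_of_sum_le hsum fun s => by
    have := hN m hm n hn s
    simp only [← latticeFourierCoeff_sub hB ((hf _).integrable one_le_two)
      ((hf _).integrable one_le_two)] at this
    exact this
  exact le_of_mul_le_mul_left this hdet

namespace SobolevField

variable {B : Matrix (Fin 2) (Fin 2) ℝ}

/-- The mixed products of partial derivatives in the determinant of the gradient have the same
integral, i.e. the Jacobian determinant is a null Lagrangian. -/
lemma integral_grad_mul_grad (hB : B.det ≠ 0) (u : SobolevField B) :
    ∫ x in cell B, u.grad x 0 1 * u.grad x 1 0 = ∫ x in cell B, u.grad x 0 0 * u.grad x 1 1 := by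
  have h1 := hasSum_latticeFourierCoeff hB (u.grad_memLp 0 1) (u.grad_memLp 1 0)
  have h2 := hasSum_latticeFourierCoeff hB (u.grad_memLp 0 0) (u.grad_memLp 1 1)
  have hc : ∀ i j n, latticeFourierCoeff B (fun x => u.grad x i j) n
      = waveVector B n j * Complex.I * latticeFourierCoeff B (fun x => u.toFun x i) n :=
    fun i j n => (u.weak_grad i j).latticeFourierCoeff hB ((u.memLp i).integrable one_le_two)
      ((u.grad_memLp i j).integrable one_le_two) n
  simp only [hc, map_mul, Complex.conj_ofReal] at h1 h2
  -- With wave vector `k`, the `n`-th Parseval term on either side is `k₀ k₁ conj(û₀) û₁`.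
  have e := h1.unique (h2.congr_fun fun n => by ring)
  exact mul_left_cancel₀ (inv_ne_zero (abs_ne_zero.mpr hB)) (Complex.ofReal_injective e)

end SobolevField

end TwistedBilayer

/-! ### Convergence in `L²`, smooth periodic functions, completeness of `W^{1,2}` -/

namespace TwistedBilayer

open Filter Topology

section SquareIntegrable

variable {α : Type*} [MeasurableSpace α] {μ : Measure α}

lemma inner_toLp_eq_integral {f g : α → ℝ} (hf : MemLp f 2 μ) (hg : MemLp g 2 μ) :
    inner ℝ (hf.toLp f) (hg.toLp g) = ∫ x, f x * g x ∂μ := by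
  rw [L2.inner_def]
  refine integral_congr_ae ?_
  filter_upwards [hf.coeFn_toLp, hg.coeFn_toLp] with x h1 h2
  rw [h1, h2]
  simp [mul_comm]

lemma norm_sq_toLp_sub {f g : α → ℝ} (hf : MemLp f 2 μ) (hg : MemLp g 2 μ) :
    ‖hf.toLp f - hg.toLp g‖ ^ 2 = ∫ x, (f x - g x) ^ 2 ∂μ := by
  rw [← MemLp.toLp_sub hf hg, ← real_inner_self_eq_norm_sq, inner_toLp_eq_integral]
  simp only [Pi.sub_apply, sq]

lemma tendsto_toLp_iff {f : ℕ → α → ℝ} {g : α → ℝ} (hf : ∀ n, MemLp (f n) 2 μ)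
    (hg : MemLp g 2 μ) :
    Tendsto (fun n => (hf n).toLp (f n)) atTop (𝓝 (hg.toLp g)) ↔
      Tendsto (fun n => ∫ x, (f n x - g x) ^ 2 ∂μ) atTop (𝓝 0) := by
  rw [tendsto_iff_norm_sub_tendsto_zero]
  simp only [← norm_sq_toLp_sub (hf _) hg]
  constructor
  · intro h
    simpa using h.pow 2
  · intro h
    simpa [Real.sqrt_sq] using h.sqrt

lemma tendsto_integral_mul_of_tendsto_integral_sq {f g : ℕ → α → ℝ} {f' g' : α → ℝ}
    (hf : ∀ n, MemLp (f n) 2 μ) (hf' : MemLp f' 2 μ) (hg : ∀ n, MemLp (g n) 2 μ)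
    (hg' : MemLp g' 2 μ) (h1 : Tendsto (fun n => ∫ x, (f n x - f' x) ^ 2 ∂μ) atTop (𝓝 0))
    (h2 : Tendsto (fun n => ∫ x, (g n x - g' x) ^ 2 ∂μ) atTop (𝓝 0)) :
    Tendsto (fun n => ∫ x, f n x * g n x ∂μ) atTop (𝓝 (∫ x, f' x * g' x ∂μ)) := by
  have := ((tendsto_toLp_iff hf hf').mpr h1).inner (𝕜 := ℝ) ((tendsto_toLp_iff hg hg').mpr h2)
  simpa only [inner_toLp_eq_integral] using this

lemma tendsto_integral_mul_right_of_tendsto_integral_sq {f : ℕ → α → ℝ} {f' g : α → ℝ}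
    (hf : ∀ n, MemLp (f n) 2 μ) (hf' : MemLp f' 2 μ) (hg : MemLp g 2 μ)
    (h1 : Tendsto (fun n => ∫ x, (f n x - f' x) ^ 2 ∂μ) atTop (𝓝 0)) :
    Tendsto (fun n => ∫ x, f n x * g x ∂μ) atTop (𝓝 (∫ x, f' x * g x ∂μ)) :=
  tendsto_integral_mul_of_tendsto_integral_sq hf hf' (fun _ => hg) hg h1 (by simp)

/-- Completeness of `L²`, in terms of integrals of squares. -/
lemma exists_tendsto_integral_sq_of_cauchy {f : ℕ → α → ℝ} (hf : ∀ n, MemLp (f n) 2 μ)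
    (h : ∀ ε > 0, ∃ N, ∀ m ≥ N, ∀ n ≥ N, ∫ x, (f m x - f n x) ^ 2 ∂μ ≤ ε) :
    ∃ g : α → ℝ, MemLp g 2 μ ∧ Tendsto (fun n => ∫ x, (f n x - g x) ^ 2 ∂μ) atTop (𝓝 0) := by
  have hc : CauchySeq fun n => (hf n).toLp (f n) := by
    rw [Metric.cauchySeq_iff]
    intro ε hε
    obtain ⟨N, hN⟩ := h ((ε / 2) ^ 2) (by positivity)
    refine ⟨N, fun m hm n hn => ?_⟩
    have := hN m hm n hn
    rw [← norm_sq_toLp_sub (hf m) (hf n)] at this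
    rw [dist_eq_norm]
    linarith [abs_le_of_sq_le_sq' this (by positivity)]
  obtain ⟨g, hg⟩ := cauchySeq_tendsto_of_complete hc
  refine ⟨g, Lp.memLp g, (tendsto_toLp_iff hf (Lp.memLp g)).mp ?_⟩
  rwa [Lp.toLp_coeFn]

/-- Cauchy–Schwarz against the constant 1. -/
lemma integral_abs_le_sqrt [IsFiniteMeasure μ] {f : α → ℝ} (hf : MemLp f 2 μ) :
    ∫ x, |f x| ∂μ ≤ Real.sqrt (μ.real Set.univ) * Real.sqrt (∫ x, f x ^ 2 ∂μ) := by
  have h1 : MemLp (fun _ : α => (1 : ℝ)) 2 μ := memLp_const 1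
  have h2 := real_inner_le_norm (h1.toLp _) (hf.abs.toLp _)
  have e : ∀ {g : α → ℝ} (hg : MemLp g 2 μ), ‖hg.toLp g‖ = Real.sqrt (∫ x, g x ^ 2 ∂μ) :=
    fun hg => by
      rw [← Real.sqrt_sq (norm_nonneg _), ← real_inner_self_eq_norm_sq, inner_toLp_eq_integral]
      simp only [sq]
  rw [inner_toLp_eq_integral, e, e] at h2
  simpa using h2

end SquareIntegrable

section Periodic

variable {B : Matrix (Fin 2) (Fin 2) ℝ}

/-- The representative in the unit cell of a point of the plane. -/
noncomputable def cellRepr (B : Matrix (Fin 2) (Fin 2) ℝ) (x : Plane) : Plane :=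
  B.mulVec fun i => Int.fract (B⁻¹.mulVec x i)

lemma cellRepr_mem (B : Matrix (Fin 2) (Fin 2) ℝ) (x : Plane) : cellRepr B x ∈ cell B :=
  ⟨_, fun _ => ⟨Int.fract_nonneg _, Int.fract_lt_one _⟩, rfl⟩

lemma cellRepr_eq_self (hB : B.det ≠ 0) {x : Plane} (hx : x ∈ cell B) : cellRepr B x = x := by
  obtain ⟨s, hs, rfl⟩ := hx
  rw [cellRepr, Matrix.mulVec_mulVec, Matrix.nonsing_inv_mul _ (isUnit_iff_ne_zero.mpr hB),
    Matrix.one_mulVec]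
  congr 1
  funext i
  exact Int.fract_eq_self.mpr (hs i)

lemma cellRepr_add_lattice (hB : B.det ≠ 0) (k : Fin 2 → ℤ) (x : Plane) :
    cellRepr B (x + B.mulVec fun i => (k i : ℝ)) = cellRepr B x := by
  rw [cellRepr, Matrix.mulVec_add, Matrix.mulVec_mulVec,
    Matrix.nonsing_inv_mul _ (isUnit_iff_ne_zero.mpr hB), Matrix.one_mulVec]
  simp only [Pi.add_apply, Int.fract_add_intCast]
  rfl

lemma LatticePeriodic.apply_cellRepr {α : Type*} (hB : B.det ≠ 0) {f : Plane → α}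
    (hf : LatticePeriodic B f) (x : Plane) : f (cellRepr B x) = f x := by
  rw [← hf (fun i => ⌊B⁻¹.mulVec x i⌋) (cellRepr B x), cellRepr, ← Matrix.mulVec_add]
  congr 1
  have : ((fun i => Int.fract (B⁻¹.mulVec x i)) + fun i => (⌊B⁻¹.mulVec x i⌋ : ℝ))
      = B⁻¹.mulVec x := funext fun i => Int.fract_add_floor _
  rw [this, Matrix.mulVec_mulVec, Matrix.mul_nonsing_inv _ (isUnit_iff_ne_zero.mpr hB),
    Matrix.one_mulVec]

lemma LatticePeriodic.exists_norm_le {E : Type*} [NormedAddCommGroup E] (hB : B.det ≠ 0)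
    {f : Plane → E} (hf : LatticePeriodic B f) (hc : Continuous f) : ∃ C, ∀ x, ‖f x‖ ≤ C := by
  have hK : IsCompact ((Matrix.toLin' B) '' (Set.univ.pi fun _ => Set.Icc (0 : ℝ) 1)) :=
    (isCompact_univ_pi fun _ => isCompact_Icc).image (LinearMap.continuous_of_finiteDimensional _)
  obtain ⟨C, hC⟩ := hK.exists_bound_of_continuousOn hc.continuousOn
  refine ⟨C, fun x => ?_⟩
  rw [← hf.apply_cellRepr hB x]
  have := cellRepr_mem B x
  rw [cell_eq_image] at this
  exact hC _ (Set.image_mono (Set.pi_mono fun _ _ => Set.Ico_subset_Icc_self) this)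

lemma LatticePeriodic.fderiv {f : Plane → ℝ} (hf : LatticePeriodic B f) :
    LatticePeriodic B (fderiv ℝ f) := fun k x => by
  rw [← fderiv_comp_add_right]
  congr 1
  exact funext (hf k)

lemma LatticePeriodic.memLp (hB : B.det ≠ 0) {f : Plane → ℝ} (hf : LatticePeriodic B f)
    (hc : Continuous f) : MemLp f 2 (volume.restrict (cell B)) := by
  obtain ⟨C, hC⟩ := hf.exists_norm_le hB hc
  exact MemLp.of_bound hc.aestronglyMeasurable C (Eventually.of_forall hC)

lemma memLp_fderiv_apply (hB : B.det ≠ 0) {f : Plane → ℝ} (hf : LatticePeriodic B f)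
    (hc : ContDiff ℝ ∞ f) (v : Plane) :
    MemLp (fun x => fderiv ℝ f x v) 2 (volume.restrict (cell B)) := by
  refine LatticePeriodic.memLp hB (fun k x => by rw [hf.fderiv k x]) ?_
  exact (hc.continuous_fderiv (by simp)).clm_apply continuous_const

/-- By translation invariance `t ↦ ∫ f (x + t v)` is constant; differentiate under the integral at
`t = 0`. -/
lemma integral_fderiv_eq_zero (hB : B.det ≠ 0) {f : Plane → ℝ} (hf : LatticePeriodic B f)
    (hc : ContDiff ℝ ∞ f) (v : Plane) : ∫ x in cell B, fderiv ℝ f x v = 0 := by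
  have hc' : Continuous (fderiv ℝ f) := hc.continuous_fderiv (by simp)
  obtain ⟨C, hC⟩ := hf.fderiv.exists_norm_le hB hc'
  have hd : ∀ x t, HasDerivAt (fun t : ℝ => f (x + t • v)) (fderiv ℝ f (x + t • v) v) t := by
    intro x t
    have h1 : HasFDerivAt f (fderiv ℝ f (x + t • v)) (x + t • v) :=
      (hc.differentiable (by simp) _).hasFDerivAt
    have h2 : HasDerivAt (fun t : ℝ => x + t • v) v t := by
      simpa using ((hasDerivAt_id t).smul_const v).const_add x
    exact h1.comp_hasDerivAt t h2
  have h := (hasDerivAt_integral_of_dominated_loc_of_deriv_le (μ := volume.restrict (cell B))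
    (F := fun t x => f (x + t • v)) (F' := fun t x => fderiv ℝ f (x + t • v) v)
    (x₀ := (0 : ℝ)) (s := Set.univ) (bound := fun _ => C * ‖v‖) univ_mem
    (Eventually.of_forall fun t =>
      (hc.continuous.comp (by fun_prop : Continuous fun x : Plane => x + t • v)).aestronglyMeasurable)
    (by simpa using (hf.memLp hB hc.continuous).integrable one_le_two)
    (by simpa using (memLp_fderiv_apply hB hf hc v).1)
    (Eventually.of_forall fun x t _ => ((fderiv ℝ f _).le_opNorm v).trans
      (mul_le_mul_of_nonneg_right (hC _) (norm_nonneg _)))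
    (integrable_const _) (Eventually.of_forall fun x t _ => hd x t)).2
  simp only [integral_cell_add hB hc.continuous hf, zero_smul, add_zero] at h
  exact h.unique (hasDerivAt_const _ _)

/-- The derivative of `f φ` integrates to zero, and the product rule splits it. -/
lemma isWeakPartial_fderiv (hB : B.det ≠ 0) {f : Plane → ℝ} (hf : LatticePeriodic B f)
    (hc : ContDiff ℝ ∞ f) (j : Fin 2) :
    IsWeakPartial B j f fun x => fderiv ℝ f x (Pi.single j 1) := by
  intro φ hφ hφp
  have h := integral_fderiv_eq_zero hB (f := fun x => f x * φ x)
    (fun k x => by simp only [hf k x, hφp k x]) (hc.mul hφ) (Pi.single j 1)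
  have e : ∀ x, fderiv ℝ (fun x => f x * φ x) x (Pi.single j 1)
      = f x * fderiv ℝ φ x (Pi.single j 1) + fderiv ℝ f x (Pi.single j 1) * φ x := fun x => by
    rw [fderiv_fun_mul (hc.differentiable (by simp) x) (hφ.differentiable (by simp) x)]
    simp [mul_comm]
  simp only [e] at h
  rw [integral_add] at h
  · linarith
  · exact (hf.memLp hB hc.continuous).integrable_mul (memLp_fderiv_apply hB hφp hφ _)
  · exact (memLp_fderiv_apply hB hf hc _).integrable_mul (hφp.memLp hB hφ.continuous)

lemma isWeakPartial_zero (j : Fin 2) :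
    IsWeakPartial B j (fun _ => 0) fun _ => 0 := fun φ _ _ => by simp

end Periodic

namespace SobolevField

variable {B : Matrix (Fin 2) (Fin 2) ℝ}

/-- The zero field. -/
def zero (B : Matrix (Fin 2) (Fin 2) ℝ) : SobolevField B where
  toFun _ := 0
  grad _ := 0
  periodic _ _ := rfl
  grad_periodic _ _ := rfl
  memLp _ := by simp
  grad_memLp _ _ := by simp
  weak_grad _ j := isWeakPartial_zero j

/-- The linear combination `a u + b v`. -/
def linComb (hB : B.det ≠ 0) (a b : ℝ) (u v : SobolevField B) : SobolevField B where
  toFun x := a • u.toFun x + b • v.toFun x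
  grad x := a • u.grad x + b • v.grad x
  periodic k x := by simp only [u.periodic k x, v.periodic k x]
  grad_periodic k x := by simp only [u.grad_periodic k x, v.grad_periodic k x]
  memLp i := ((u.memLp i).const_mul a).add ((v.memLp i).const_mul b)
  grad_memLp i j := ((u.grad_memLp i j).const_mul a).add ((v.grad_memLp i j).const_mul b)
  weak_grad i j φ hφ hp := by
    have hu := u.weak_grad i j φ hφ hp
    have hv := v.weak_grad i j φ hφ hp
    have m1 := memLp_fderiv_apply hB hp hφ (Pi.single j 1)
    have m2 := hp.memLp hB hφ.continuous
    have i1 : Integrable (fun x => u.toFun x i * fderiv ℝ φ x (Pi.single j 1))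
      (volume.restrict (cell B)) := (u.memLp i).integrable_mul m1
    have i2 : Integrable (fun x => v.toFun x i * fderiv ℝ φ x (Pi.single j 1))
      (volume.restrict (cell B)) := (v.memLp i).integrable_mul m1
    have i3 : Integrable (fun x => u.grad x i j * φ x) (volume.restrict (cell B)) :=
      (u.grad_memLp i j).integrable_mul m2
    have i4 : Integrable (fun x => v.grad x i j * φ x) (volume.restrict (cell B)) :=
      (v.grad_memLp i j).integrable_mul m2
    calc ∫ x in cell B, (a * u.toFun x i + b * v.toFun x i) * fderiv ℝ φ x (Pi.single j 1)
        = ∫ x in cell B, (a * (u.toFun x i * fderiv ℝ φ x (Pi.single j 1))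
            + b * (v.toFun x i * fderiv ℝ φ x (Pi.single j 1))) := by
          simp only [add_mul, mul_assoc]
      _ = -∫ x in cell B, (a * (u.grad x i j * φ x) + b * (v.grad x i j * φ x)) := by
          rw [integral_add (i1.const_mul a) (i2.const_mul b), integral_add (i3.const_mul a)
            (i4.const_mul b), integral_const_mul, integral_const_mul, integral_const_mul,
            integral_const_mul, hu, hv]
          ring
      _ = -∫ x in cell B, (a * u.grad x i j + b * v.grad x i j) * φ x := by
          simp only [add_mul, mul_assoc]

lemma MeanZero.linComb {hB : B.det ≠ 0} {a b : ℝ} {u v : SobolevField B} (hu : u.MeanZero)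
    (hv : v.MeanZero) : (u.linComb hB a b v).MeanZero := fun i => by
  simp only [SobolevField.linComb, Pi.add_apply, Pi.smul_apply, smul_eq_mul]
  rw [integral_add (((u.memLp i).integrable one_le_two).const_mul a)
    (((v.memLp i).integrable one_le_two).const_mul b), integral_const_mul, integral_const_mul,
    hu i, hv i, mul_zero, mul_zero, add_zero]

/-- Completeness of `W^{1,2}`. -/
lemma exists_tendsto_of_cauchy (hB : B.det ≠ 0) (u : ℕ → SobolevField B)
    (h : ∀ i, ∀ ε > 0, ∃ N, ∀ m ≥ N, ∀ n ≥ N,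
      ∫ x in cell B, ((u m).toFun x i - (u n).toFun x i) ^ 2 ≤ ε)
    (hgrad : ∀ i j, ∀ ε > 0, ∃ N, ∀ m ≥ N, ∀ n ≥ N,
      ∫ x in cell B, ((u m).grad x i j - (u n).grad x i j) ^ 2 ≤ ε) :
    ∃ v : SobolevField B,
      (∀ i, Tendsto (fun n => ∫ x in cell B, ((u n).toFun x i - v.toFun x i) ^ 2) atTop (𝓝 0)) ∧
      ∀ i j, Tendsto (fun n => ∫ x in cell B, ((u n).grad x i j - v.grad x i j) ^ 2)
        atTop (𝓝 0) := by
  choose f hf hft using fun i => exists_tendsto_integral_sq_of_cauchy (fun n => (u n).memLp i) (h i)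
  choose g hg hgt using fun i j =>
    exists_tendsto_integral_sq_of_cauchy (fun n => (u n).grad_memLp i j) (hgrad i j)
  -- The `L²` limits carry no information off the cell. Composing with `cellRepr` makes them
  -- periodic and leaves them unchanged on the cell.
  have hae : ∀ {F : Plane → ℝ}, F =ᵐ[volume.restrict (cell B)] fun x => F (cellRepr B x) := by
    intro F
    filter_upwards [ae_restrict_mem (measurableSet_cell hB)] with x hx
    rw [cellRepr_eq_self hB hx]
  refine ⟨{ toFun := fun x i => f i (cellRepr B x)
            grad := fun x => Matrix.of fun i j => g i j (cellRepr B x)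
            periodic := fun k x => by simp only [cellRepr_add_lattice hB]
            grad_periodic := fun k x => by simp only [cellRepr_add_lattice hB]
            memLp := fun i => (hf i).ae_eq hae
            grad_memLp := fun i j => (hg i j).ae_eq hae
            weak_grad := fun i j φ hφ hp => ?_ }, fun i => ?_, fun i j => ?_⟩
  · have m1 := memLp_fderiv_apply hB hp hφ (Pi.single j 1)
    have m2 := hp.memLp hB hφ.continuous
    have e1 : ∫ x in cell B, f i (cellRepr B x) * fderiv ℝ φ x (Pi.single j 1)
        = ∫ x in cell B, f i x * fderiv ℝ φ x (Pi.single j 1) :=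
      integral_congr_ae ((hae (F := f i)).symm.mul (EventuallyEq.refl _ _))
    have e2 : ∫ x in cell B, g i j (cellRepr B x) * φ x = ∫ x in cell B, g i j x * φ x :=
      integral_congr_ae ((hae (F := g i j)).symm.mul (EventuallyEq.refl _ _))
    -- Each side of the integration by parts formula is an `L²` pairing with a fixed function, so
    -- the formula survives the limit.
    have t1 := tendsto_integral_mul_right_of_tendsto_integral_sq (fun n => (u n).memLp i)
      (hf i) m1 (hft i)
    have t2 := tendsto_integral_mul_right_of_tendsto_integral_sq (fun n => (u n).grad_memLp i j)
      (hg i j) m2 (hgt i j)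
    simp only [(u _).weak_grad i j φ hφ hp] at t1
    simp only [Matrix.of_apply]
    rw [e1, e2]
    exact tendsto_nhds_unique t1 t2.neg
  · refine (hft i).congr fun n => integral_congr_ae ?_
    filter_upwards [hae (F := f i)] with x hx
    rw [← hx]
  · refine (hgt i j).congr fun n => integral_congr_ae ?_
    filter_upwards [hae (F := g i j)] with x hx
    rw [Matrix.of_apply, ← hx]

end SobolevField

end TwistedBilayer

/-! ### Elastic energy and the best Korn constant -/

namespace TwistedBilayer

open Filter Topology

variable {B : Matrix (Fin 2) (Fin 2) ℝ}

namespace SobolevField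

/-- Twice the elastic energy, i.e. the left-hand side of the Korn-type inequality. -/
noncomputable def elastic (lam mu : ℝ) (u : SobolevField B) : ℝ :=
  ∫ x in cell B, (lam * (u.div x) ^ 2 + 2 * mu * u.strainSq x)

lemma two_mul_intraEnergy (lam mu : ℝ) (u : SobolevField B) :
    2 * u.intraEnergy lam mu = u.elastic lam mu := by
  rw [intraEnergy, elastic, ← integral_const_mul]
  congr 1
  funext x
  ring

lemma integrable_grad_mul_grad (u : SobolevField B) (i j k l : Fin 2) :
    Integrable (fun x => u.grad x i j * u.grad x k l) (volume.restrict (cell B)) :=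
  (u.grad_memLp i j).integrable_mul (u.grad_memLp k l)

lemma integrable_grad_sq (u : SobolevField B) (i j : Fin 2) :
    Integrable (fun x => u.grad x i j ^ 2) (volume.restrict (cell B)) :=
  (u.grad_memLp i j).integrable_sq

lemma integrable_div_sq (u : SobolevField B) :
    Integrable (fun x => u.div x ^ 2) (volume.restrict (cell B)) := by
  have : MemLp (fun x => u.div x) 2 (volume.restrict (cell B)) := by
    simp only [div, Matrix.trace_fin_two]
    exact (u.grad_memLp 0 0).add (u.grad_memLp 1 1)
  exact this.integrable_sq

lemma strainSq_eq (u : SobolevField B) (x : Plane) :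
    u.strainSq x = u.grad x 0 0 ^ 2 + u.grad x 1 1 ^ 2
      + 1 / 2 * (u.grad x 0 1 ^ 2 + u.grad x 1 0 ^ 2 + 2 * (u.grad x 0 1 * u.grad x 1 0)) := by
  simp only [strainSq, strain, Fin.sum_univ_two, Matrix.smul_apply, Matrix.add_apply,
    Matrix.transpose_apply, smul_eq_mul]
  ring

lemma integrable_strainSq (u : SobolevField B) :
    Integrable u.strainSq (volume.restrict (cell B)) := by
  rw [funext u.strainSq_eq]
  exact ((u.integrable_grad_sq 0 0).add (u.integrable_grad_sq 1 1)).add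
    ((((u.integrable_grad_sq 0 1).add (u.integrable_grad_sq 1 0)).add
      ((u.integrable_grad_mul_grad 0 1 1 0).const_mul 2)).const_mul (1 / 2))

/-- **Korn's identity** on the torus. -/
lemma elastic_eq (hB : B.det ≠ 0) (lam mu : ℝ) (u : SobolevField B) :
    u.elastic lam mu = mu * ∑ i, ∑ j, (∫ x in cell B, u.grad x i j ^ 2)
      + (lam + mu) * ∫ x in cell B, u.div x ^ 2 := by
  have hnull := u.integral_grad_mul_grad hB
  -- The last summand is `-2 mu det ∇u`, the null Lagrangian.
  have e : ∀ x, lam * (u.div x) ^ 2 + 2 * mu * u.strainSq x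
      = ((mu * ∑ i, ∑ j, u.grad x i j ^ 2) + (lam + mu) * u.div x ^ 2)
        + 2 * mu * (u.grad x 0 1 * u.grad x 1 0 - u.grad x 0 0 * u.grad x 1 1) := fun x => by
    rw [strainSq_eq, div, Matrix.trace_fin_two]
    simp only [Fin.sum_univ_two]
    ring
  have i1 : Integrable (fun x => mu * ∑ i, ∑ j, u.grad x i j ^ 2) (volume.restrict (cell B)) :=
    (integrable_finsetSum _ fun i _ => integrable_finsetSum _ fun j _ =>
      u.integrable_grad_sq i j).const_mul mu
  have i2 := u.integrable_div_sq.const_mul (lam + mu)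
  have i12 : Integrable (fun x => (mu * ∑ i, ∑ j, u.grad x i j ^ 2) + (lam + mu) * u.div x ^ 2)
      (volume.restrict (cell B)) := i1.add i2
  have i3 : Integrable (fun x => u.grad x 0 1 * u.grad x 1 0 - u.grad x 0 0 * u.grad x 1 1)
      (volume.restrict (cell B)) :=
    (u.integrable_grad_mul_grad 0 1 1 0).sub (u.integrable_grad_mul_grad 0 0 1 1)
  rw [elastic]
  simp only [e]
  rw [integral_add i12 (i3.const_mul _), integral_add i1 i2, integral_const_mul,
    integral_const_mul, integral_const_mul,
    integral_sub (u.integrable_grad_mul_grad 0 1 1 0) (u.integrable_grad_mul_grad 0 0 1 1), hnull,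
    sub_self, mul_zero, add_zero, integral_finsetSum _ fun i _ => integrable_finsetSum _ fun j _ =>
      u.integrable_grad_sq i j]
  simp only [integral_finsetSum _ fun j _ => u.integrable_grad_sq _ j]

/-- Coercivity: `lam` may be negative, but in Korn's identity the divergence term has the
nonnegative coefficient `lam + mu` and can be dropped. -/
lemma mul_sum_integral_grad_sq_le_elastic (hB : B.det ≠ 0) {lam mu : ℝ} (h : 0 ≤ lam + mu)
    (u : SobolevField B) :
    mu * ∑ i, ∑ j, ∫ x in cell B, u.grad x i j ^ 2 ≤ u.elastic lam mu := by
  rw [elastic_eq hB]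
  exact le_add_of_nonneg_right (mul_nonneg h (integral_nonneg fun x => sq_nonneg _))

lemma elastic_nonneg (hB : B.det ≠ 0) {lam mu : ℝ} (hmu : 0 < mu) (h : 0 ≤ lam + mu)
    (u : SobolevField B) : 0 ≤ u.elastic lam mu :=
  le_trans (mul_nonneg hmu.le (Finset.sum_nonneg fun _ _ => Finset.sum_nonneg fun _ _ =>
    integral_nonneg fun _ => sq_nonneg _)) (u.mul_sum_integral_grad_sq_le_elastic hB h)

/-- The parallelogram law for the elastic energy. -/
lemma elastic_parallelogram (hB : B.det ≠ 0) (lam mu : ℝ) (u v : SobolevField B) :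
    (u.linComb hB (1 / 2) (1 / 2) v).elastic lam mu
      + 1 / 4 * (u.linComb hB 1 (-1) v).elastic lam mu
      = 1 / 2 * u.elastic lam mu + 1 / 2 * v.elastic lam mu := by
  have hi : ∀ w : SobolevField B, Integrable
      (fun x => lam * (w.div x) ^ 2 + 2 * mu * w.strainSq x) (volume.restrict (cell B)) :=
    fun w => (w.integrable_div_sq.const_mul _).add (w.integrable_strainSq.const_mul _)
  simp only [elastic]
  rw [← integral_const_mul, ← integral_const_mul, ← integral_const_mul,
    ← integral_add (hi _) ((hi _).const_mul _),
    ← integral_add ((hi _).const_mul _) ((hi _).const_mul _)]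
  congr 1
  funext x
  simp only [strainSq_eq, div, Matrix.trace_fin_two, linComb, Matrix.add_apply, Matrix.smul_apply,
    smul_eq_mul]
  ring

lemma norm12_sq (u : SobolevField B) :
    u.norm12 ^ 2 = ∑ i, (∫ x in cell B, u.toFun x i ^ 2)
      + ∑ i, ∑ j, ∫ x in cell B, u.grad x i j ^ 2 := by
  have i1 : ∀ i, Integrable (fun x => u.toFun x i ^ 2) (volume.restrict (cell B)) :=
    fun i => (u.memLp i).integrable_sq
  rw [norm12, Real.sq_sqrt (integral_nonneg fun x => by positivity), integral_add
    (integrable_finsetSum _ fun i _ => i1 i) (integrable_finsetSum _ fun i _ =>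
      integrable_finsetSum _ fun j _ => u.integrable_grad_sq i j),
    integral_finsetSum _ fun i _ => i1 i, integral_finsetSum _ fun i _ => integrable_finsetSum _
      fun j _ => u.integrable_grad_sq i j]
  simp only [integral_finsetSum _ fun j _ => u.integrable_grad_sq _ j]

lemma gradNorm_le_norm12 (u : SobolevField B) : u.gradNorm ≤ u.norm12 := by
  refine Real.sqrt_le_sqrt (integral_mono ?_ ?_ fun x => ?_)
  · exact integrable_finsetSum _ fun i _ => integrable_finsetSum _ fun j _ =>
      u.integrable_grad_sq i j
  · exact (integrable_finsetSum _ fun i _ => (u.memLp i).integrable_sq).add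
      (integrable_finsetSum _ fun i _ => integrable_finsetSum _ fun j _ =>
      u.integrable_grad_sq i j)
  · exact le_add_of_nonneg_left (by positivity)

lemma MeanZero.integral_sq_le (hB : B.det ≠ 0) {u : SobolevField B} (hu : u.MeanZero) (i : Fin 2) :
    ∫ x in cell B, u.toFun x i ^ 2
      ≤ (∑ i, ∑ j, B i j ^ 2) * ∑ j, ∫ x in cell B, u.grad x i j ^ 2 :=
  integral_sq_le_of_integral_eq_zero hB (u.memLp i) (u.grad_memLp i) (u.weak_grad i) (hu i)

end SobolevField

open SobolevField

/-- Poincaré gives `‖u‖²_{1,2} ≤ (1 + ∑ B i j ^ 2) ∫ |∇u|²`, and coercivity does the rest. -/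
lemma kornInequality_of_poincare (hB : B.det ≠ 0) :
    KornInequality B (1 / (1 + ∑ i, ∑ j, B i j ^ 2)) := by
  intro lam mu hmu h u hu
  refine le_trans ?_ (u.mul_sum_integral_grad_sq_le_elastic hB h)
  rw [mul_assoc]
  refine mul_le_mul_of_nonneg_left ?_ hmu.le
  rw [one_div_mul_eq_div, div_le_iff₀ (by positivity), norm12_sq, mul_add, mul_one, add_comm]
  refine add_le_add le_rfl ?_
  rw [mul_comm, Finset.mul_sum]
  exact Finset.sum_le_sum fun i _ => hu.integral_sq_le hB i

lemma measureReal_cell_pos (hB : B.det ≠ 0) : 0 < volume.real (cell B) := by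
  have h := integral_torusSection hB (F := fun _ => (1 : ℝ)) aestronglyMeasurable_const
  simp only [integral_const, smul_eq_mul, mul_one, probReal_univ, measureReal_restrict_apply_univ]
    at h
  rcases (measureReal_nonneg (μ := volume) (s := cell B)).lt_or_eq with h0 | h0
  · exact h0
  · rw [← h0, mul_zero] at h
    exact absurd h one_ne_zero

/-- The plane wave `(cos (2π e₁ · B⁻¹ x), 0)`. -/
noncomputable def cosField (hB : B.det ≠ 0) : SobolevField B where
  toFun x := Pi.single 0 (Real.cos (phase B (Pi.single 0 1) x))
  grad x := Matrix.of fun i j => Pi.single (M := fun _ => ℝ) 0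
    (fderiv ℝ (fun x => Real.cos (phase B (Pi.single 0 1) x)) x (Pi.single j 1)) i
  periodic k x := by simp only [latticePeriodic_cos_phase hB (Pi.single 0 1) k x]
  grad_periodic k x := by
    simp only [(latticePeriodic_cos_phase hB (Pi.single 0 1)).fderiv k x]
  memLp i := by
    fin_cases i
    · simpa using (latticePeriodic_cos_phase hB (Pi.single 0 1)).memLp hB
        (Real.continuous_cos.comp (continuous_phase B _))
    · simp
  grad_memLp i j := by
    fin_cases i
    · simpa using memLp_fderiv_apply hB (latticePeriodic_cos_phase hB (Pi.single 0 1))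
        (Real.contDiff_cos.comp (contDiff_phase B _)) (Pi.single j 1)
    · simp
  weak_grad i j := by
    fin_cases i
    · simpa using isWeakPartial_fderiv hB (latticePeriodic_cos_phase hB (Pi.single 0 1))
        (Real.contDiff_cos.comp (contDiff_phase B _)) j
    · simpa using isWeakPartial_zero j

lemma exists_waveVector_ne_zero (hB : B.det ≠ 0) : ∃ j, waveVector B (Pi.single 0 1) j ≠ 0 := by
  by_contra! h
  have := two_pi_mul_eq_sum_waveVector hB (Pi.single 0 1) 0
  simp [h, Real.pi_ne_zero] at this

/-- The cosine is, up to a nonzero wave vector component, a derivative of the periodic sine. -/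
lemma meanZero_cosField (hB : B.det ≠ 0) : (cosField hB).MeanZero := by
  obtain ⟨j, hj⟩ := exists_waveVector_ne_zero hB
  intro i
  fin_cases i
  · have h := integral_fderiv_eq_zero hB (latticePeriodic_sin_phase hB (Pi.single 0 1))
      (Real.contDiff_sin.comp (contDiff_phase B _)) (Pi.single j 1)
    simp only [fderiv_sin_phase, integral_const_mul, mul_eq_zero, hj,
      false_or] at h
    simpa [cosField] using h
  · simp [cosField]

/-- Integration by parts shows that `sin²` and `cos²` have equal integrals; they add up to the
positive area of the cell. -/
lemma norm12_cosField_pos (hB : B.det ≠ 0) : 0 < (cosField hB).norm12 ^ 2 := by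
  obtain ⟨j, hj⟩ := exists_waveVector_ne_zero hB
  have hcd : ContDiff ℝ ∞ fun x => Real.cos (phase B (Pi.single 0 1) x) :=
    Real.contDiff_cos.comp (contDiff_phase B _)
  have hsd : ContDiff ℝ ∞ fun x => Real.sin (phase B (Pi.single 0 1) x) :=
    Real.contDiff_sin.comp (contDiff_phase B _)
  have hcp := latticePeriodic_cos_phase hB (Pi.single 0 1)
  have hsp := latticePeriodic_sin_phase hB (Pi.single 0 1)
  have h := isWeakPartial_fderiv hB hsp hsd j _ hcd hcp
  simp only [fderiv_cos_phase, fderiv_sin_phase] at h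
  have hs : ∫ x in cell B, Real.sin (phase B (Pi.single 0 1) x) ^ 2
      = ∫ x in cell B, Real.cos (phase B (Pi.single 0 1) x) ^ 2 := by
    refine mul_left_cancel₀ (neg_ne_zero.mpr hj) ?_
    rw [← integral_const_mul, neg_mul, ← integral_const_mul]
    refine Eq.trans (integral_congr_ae (Eventually.of_forall fun x => ?_)) (h.trans
      (congrArg Neg.neg (integral_congr_ae (Eventually.of_forall fun x => ?_))))
    · ring
    · ring
  have hsum : ∫ x in cell B, (Real.sin (phase B (Pi.single 0 1) x) ^ 2
      + Real.cos (phase B (Pi.single 0 1) x) ^ 2) = volume.real (cell B) := by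
    simp
  rw [integral_add (hsp.memLp hB hsd.continuous).integrable_sq
    (hcp.memLp hB hcd.continuous).integrable_sq, hs] at hsum
  have hpos := measureReal_cell_pos hB
  have e : ∫ x in cell B, (cosField hB).toFun x 0 ^ 2
      = ∫ x in cell B, Real.cos (phase B (Pi.single 0 1) x) ^ 2 := by simp [cosField]
  rw [norm12_sq, Fin.sum_univ_two, e]
  have h1 : 0 ≤ ∫ x in cell B, (cosField hB).toFun x 1 ^ 2 := integral_nonneg fun _ => sq_nonneg _
  have h2 : 0 ≤ ∑ i, ∑ j, ∫ x in cell B, (cosField hB).grad x i j ^ 2 :=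
    Finset.sum_nonneg fun _ _ => Finset.sum_nonneg fun _ _ => integral_nonneg fun _ => sq_nonneg _
  linarith

/-- Testing one nonzero field with `lam = 0`, `mu = 1` caps every admissible constant by its
Rayleigh quotient. -/
lemma bddAbove_kornInequality (hB : B.det ≠ 0) : BddAbove {c : ℝ | KornInequality B c} := by
  refine ⟨(cosField hB).elastic 0 1 / (cosField hB).norm12 ^ 2, fun c hc => ?_⟩
  rw [le_div_iff₀ (norm12_cosField_pos hB)]
  have h := hc 0 1 one_pos (by norm_num) (cosField hB) (meanZero_cosField hB)
  rwa [one_mul] at h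

/-- There is a best constant in the Korn-type inequality, and it is positive. -/
lemma exists_isGreatest_kornInequality (hB : B.det ≠ 0) :
    ∃ C, 0 < C ∧ IsGreatest {c : ℝ | KornInequality B c} C := by
  have hne := kornInequality_of_poincare hB
  have hbdd := bddAbove_kornInequality hB
  refine ⟨sSup {c : ℝ | KornInequality B c}, lt_of_lt_of_le (by positivity) (le_csSup hbdd hne), ?_,
    fun c hc => le_csSup hbdd hc⟩
  intro lam mu hmu h u hu
  -- For a field of positive norm, its Rayleigh quotient bounds all admissible constants, hence
  -- their supremum.
  rcases (sq_nonneg u.norm12).eq_or_lt with h0 | h0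
  · rw [← h0, mul_zero]
    exact u.elastic_nonneg hB hmu h
  · have hpos : 0 < mu * u.norm12 ^ 2 := mul_pos hmu h0
    rw [mul_right_comm, mul_comm, ← le_div_iff₀ hpos]
    refine csSup_le ⟨_, hne⟩ fun c hc => ?_
    rw [le_div_iff₀ hpos, mul_comm, mul_right_comm]
    exact hc lam mu hmu h u hu

/-! ### The misfit energy: lower bound and Lipschitz continuity -/

section Misfit

/-- The integrand of the misfit energy. -/
noncomputable def misfit (Ψ : Plane → ℝ) (θ : ℝ) (x w : Plane) : ℝ :=
  1 / 2 * (Ψ (x - (matJ * rot (θ / 2)).mulVec w) + Ψ (x - (matJ * rot (-(θ / 2))).mulVec w))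

variable {Ψ : Plane → ℝ} (θ : ℝ)

lemma bddBelow_range_of_periodic (hB : B.det ≠ 0) (hp : LatticePeriodic B Ψ) (hc : Continuous Ψ) :
    BddBelow (Set.range Ψ) := by
  obtain ⟨C, hC⟩ := hp.exists_norm_le hB hc
  exact ⟨-C, by rintro _ ⟨x, rfl⟩; exact (abs_le.mp (hC x)).1⟩

lemma integrable_misfit (hB : B.det ≠ 0) (hp : LatticePeriodic B Ψ) (hc : Continuous Ψ)
    {v : Plane → Plane} (hv : AEStronglyMeasurable v (volume.restrict (cell B))) :
    Integrable (fun x => misfit Ψ θ x (v x)) (volume.restrict (cell B)) := by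
  obtain ⟨C, hC⟩ := hp.exists_norm_le hB hc
  have key : ∀ M : Matrix (Fin 2) (Fin 2) ℝ,
      Integrable (fun x => Ψ (x - M.mulVec (v x))) (volume.restrict (cell B)) := fun M =>
    Integrable.of_bound (hc.comp_aestronglyMeasurable (aestronglyMeasurable_id.sub
      ((Continuous.matrix_mulVec continuous_const continuous_id).comp_aestronglyMeasurable hv)))
      C (Eventually.of_forall fun x => hC _)
  exact ((key _).add (key _)).const_mul _

lemma SobolevField.aestronglyMeasurable (u : SobolevField B) :
    AEStronglyMeasurable u.toFun (volume.restrict (cell B)) :=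
  (aemeasurable_pi_lambda _ fun i => (u.memLp i).1.aemeasurable).aestronglyMeasurable

lemma iInf_le_misfit (hB : B.det ≠ 0) (hp : LatticePeriodic B Ψ) (hc : Continuous Ψ)
    (x w : Plane) : ⨅ y, Ψ y ≤ misfit Ψ θ x w := by
  have hb := bddBelow_range_of_periodic hB hp hc
  have h1 := ciInf_le hb (x - (matJ * rot (θ / 2)).mulVec w)
  have h2 := ciInf_le hb (x - (matJ * rot (-(θ / 2))).mulVec w)
  rw [misfit]
  linarith

/-- A continuous periodic derivative is bounded; apply the mean value inequality. -/
lemma exists_lipschitz_of_periodic (hB : B.det ≠ 0) (hp : LatticePeriodic B Ψ)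
    (hc : ContDiff ℝ 1 Ψ) : ∃ L, 0 ≤ L ∧ ∀ x y, |Ψ x - Ψ y| ≤ L * ‖x - y‖ := by
  obtain ⟨C, hC⟩ := hp.fderiv.exists_norm_le hB (hc.continuous_fderiv (by simp))
  refine ⟨C, (norm_nonneg _).trans (hC 0), fun x y => ?_⟩
  exact convex_univ.norm_image_sub_le_of_norm_fderiv_le
    (fun x _ => hc.differentiable (by simp) x) (fun x _ => hC x) (Set.mem_univ y) (Set.mem_univ x)

lemma exists_norm_mulVec_le (M : Matrix (Fin 2) (Fin 2) ℝ) :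
    ∃ K, 0 ≤ K ∧ ∀ w : Plane, ‖M.mulVec w‖ ≤ K * ∑ i, |w i| := by
  refine ⟨‖LinearMap.toContinuousLinearMap (Matrix.toLin' M)‖, norm_nonneg _, fun w => ?_⟩
  refine ((LinearMap.toContinuousLinearMap (Matrix.toLin' M)).le_opNorm w).trans
    (mul_le_mul_of_nonneg_left ?_ (norm_nonneg _))
  exact (pi_norm_le_iff_of_nonneg (by positivity)).mpr fun i =>
    Finset.single_le_sum (f := fun i => |w i|) (fun _ _ => abs_nonneg _) (Finset.mem_univ i)

/-- The bound is uniform in `x`, and its `ℓ¹` form allows Cauchy–Schwarz component by component. -/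
lemma exists_misfit_sub_le (hB : B.det ≠ 0) (hp : LatticePeriodic B Ψ) (hc : ContDiff ℝ 1 Ψ) :
    ∃ L, 0 ≤ L ∧ ∀ x v w, |misfit Ψ θ x v - misfit Ψ θ x w| ≤ L * ∑ i, |v i - w i| := by
  obtain ⟨L, hL, hΨ⟩ := exists_lipschitz_of_periodic hB hp hc
  have key : ∀ M : Matrix (Fin 2) (Fin 2) ℝ, ∃ K, 0 ≤ K ∧ ∀ x v w : Plane,
      |Ψ (x - M.mulVec v) - Ψ (x - M.mulVec w)| ≤ K * ∑ i, |v i - w i| := fun M => by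
    obtain ⟨K, hK, h⟩ := exists_norm_mulVec_le M
    refine ⟨L * K, mul_nonneg hL hK, fun x v w => (hΨ _ _).trans ?_⟩
    rw [mul_assoc, sub_sub_sub_cancel_left, ← Matrix.mulVec_sub]
    refine mul_le_mul_of_nonneg_left ((h _).trans_eq ?_) hL
    simp only [Pi.sub_apply, abs_sub_comm]
  obtain ⟨K1, h1, hK1⟩ := key (matJ * rot (θ / 2))
  obtain ⟨K2, h2, hK2⟩ := key (matJ * rot (-(θ / 2)))
  refine ⟨1 / 2 * (K1 + K2), by positivity, fun x v w => ?_⟩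
  rw [misfit, misfit, ← mul_sub, add_sub_add_comm, abs_mul, abs_of_pos (one_half_pos (α := ℝ)),
    mul_assoc, add_mul]
  exact mul_le_mul_of_nonneg_left ((abs_add_le _ _).trans (add_le_add (hK1 x v w) (hK2 x v w)))
    one_half_pos.le

lemma interEnergy_eq (v : Plane → Plane) :
    interEnergy B Ψ θ v = 1 / (4 * Real.sin (θ / 2) ^ 2) * ∫ x in cell B, misfit Ψ θ x (v x) := rfl

lemma le_interEnergy (hB : B.det ≠ 0) (hp : LatticePeriodic B Ψ) (hc : Continuous Ψ)
    {v : Plane → Plane} (hv : AEStronglyMeasurable v (volume.restrict (cell B))) :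
    1 / (4 * Real.sin (θ / 2) ^ 2) * ∫ _ in cell B, ⨅ y, Ψ y ≤ interEnergy B Ψ θ v :=
  mul_le_mul_of_nonneg_left (integral_mono (integrable_const _) (integrable_misfit θ hB hp hc hv)
    fun x => iInf_le_misfit θ hB hp hc x _) (by positivity)

/-- The misfit energy is Lipschitz continuous in `L²`. -/
lemma exists_interEnergy_sub_le (hB : B.det ≠ 0) (hp : LatticePeriodic B Ψ)
    (hc : ContDiff ℝ 1 Ψ) : ∃ L, 0 ≤ L ∧ ∀ u v : SobolevField B,
      |interEnergy B Ψ θ (fun x => (2 : ℝ) • u.toFun x)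
        - interEnergy B Ψ θ (fun x => (2 : ℝ) • v.toFun x)|
      ≤ L * ∑ i, Real.sqrt (∫ x in cell B, (u.toFun x i - v.toFun x i) ^ 2) := by
  obtain ⟨L, hL, h⟩ := exists_misfit_sub_le θ hB hp hc
  set s := 1 / (4 * Real.sin (θ / 2) ^ 2) with hs
  have hs0 : 0 ≤ s := by positivity
  set V := Real.sqrt ((volume.restrict (cell B)).real Set.univ) with hV
  -- Here `s` is the energy prefactor, `L` the Lipschitz constant of the integrand, 2 comes from the
  -- displacement `2u`, and `V` from Cauchy–Schwarz on the cell.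
  refine ⟨s * (L * (2 * V)), by positivity, fun u v => ?_⟩
  have iu : Integrable (fun x => misfit Ψ θ x ((2 : ℝ) • u.toFun x)) (volume.restrict (cell B)) :=
    integrable_misfit θ hB hp hc.continuous (u.aestronglyMeasurable.const_smul (2 : ℝ))
  have iv : Integrable (fun x => misfit Ψ θ x ((2 : ℝ) • v.toFun x)) (volume.restrict (cell B)) :=
    integrable_misfit θ hB hp hc.continuous (v.aestronglyMeasurable.const_smul (2 : ℝ))
  have hm : ∀ i, MemLp (fun x => u.toFun x i - v.toFun x i) 2 (volume.restrict (cell B)) :=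
    fun i => (u.memLp i).sub (v.memLp i)
  have hi : ∀ i, Integrable (fun x => |u.toFun x i - v.toFun x i|) (volume.restrict (cell B)) :=
    fun i => ((hm i).integrable one_le_two).abs
  rw [interEnergy_eq, interEnergy_eq, ← mul_sub, abs_mul, abs_of_nonneg hs0, mul_assoc]
  refine mul_le_mul_of_nonneg_left ?_ hs0
  rw [← integral_sub iu iv]
  calc _ ≤ ∫ x in cell B, |misfit Ψ θ x ((2 : ℝ) • u.toFun x) - misfit Ψ θ x ((2 : ℝ) • v.toFun x)| :=
        abs_integral_le_integral_abs
    _ ≤ ∫ x in cell B, L * (2 * ∑ i, |u.toFun x i - v.toFun x i|) := by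
        refine integral_mono (iu.sub iv).abs
          (((integrable_finsetSum _ fun i _ => hi i).const_mul _).const_mul _) fun x => ?_
        refine (h x _ _).trans_eq ?_
        simp only [Pi.smul_apply, smul_eq_mul, ← mul_sub, abs_mul, abs_two, Finset.mul_sum]
    _ = L * (2 * ∑ i, ∫ x in cell B, |u.toFun x i - v.toFun x i|) := by
        rw [integral_const_mul, integral_const_mul, integral_finsetSum _ fun i _ => hi i]
    _ ≤ L * (2 * ∑ i, V * Real.sqrt (∫ x in cell B, (u.toFun x i - v.toFun x i) ^ 2)) := by
        gcongr with i
        exact integral_abs_le_sqrt (hm i)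
    _ = _ := by rw [← Finset.mul_sum]; ring

end Misfit

end TwistedBilayer

/-! ### The direct method and the a priori bound -/

namespace TwistedBilayer

open Filter Topology SobolevField

variable {B : Matrix (Fin 2) (Fin 2) ℝ}

lemma totalEnergy_eq (lam mu : ℝ) (Ψ : Plane → ℝ) (θ : ℝ) (u : SobolevField B) :
    totalEnergy lam mu Ψ θ u
      = u.elastic lam mu + interEnergy B Ψ θ (fun x => (2 : ℝ) • u.toFun x) := by
  rw [totalEnergy, two_mul_intraEnergy]

lemma SobolevField.integral_grad_sq_le (u : SobolevField B) (i j : Fin 2) :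
    ∫ x in cell B, u.grad x i j ^ 2 ≤ ∑ i, ∑ j, (∫ x in cell B, u.grad x i j ^ 2) :=
  (Finset.single_le_sum (f := fun j => ∫ x in cell B, u.grad x i j ^ 2)
    (fun _ _ => integral_nonneg fun _ => sq_nonneg _) (Finset.mem_univ j)).trans
  (Finset.single_le_sum (f := fun i => ∑ j, ∫ x in cell B, u.grad x i j ^ 2)
    (fun _ _ => Finset.sum_nonneg fun _ _ => integral_nonneg fun _ => sq_nonneg _)
    (Finset.mem_univ i))

/-- A sequence of mean-zero fields of bounded elastic energy has a subsequence that converges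
in `L²`. -/
lemma exists_subseq_cauchy_of_elastic_le (hB : B.det ≠ 0) {lam mu : ℝ} (hmu : 0 < mu)
    (h : 0 ≤ lam + mu) {u : ℕ → SobolevField B} (hu : ∀ n, (u n).MeanZero) {M : ℝ}
    (hM : ∀ n, (u n).elastic lam mu ≤ M) :
    ∃ φ : ℕ → ℕ, StrictMono φ ∧ ∀ i, ∀ ε > 0, ∃ N, ∀ m ≥ N, ∀ n ≥ N,
      ∫ x in cell B, ((u (φ m)).toFun x i - (u (φ n)).toFun x i) ^ 2 ≤ ε := by
  set K := ∑ i, ∑ j, B i j ^ 2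
  have hK : 0 ≤ K := by positivity
  have hS : ∀ n, ∑ i, ∑ j, (∫ x in cell B, (u n).grad x i j ^ 2) ≤ M / mu := fun n => by
    rw [le_div_iff₀ hmu, mul_comm]
    exact ((u n).mul_sum_integral_grad_sq_le_elastic hB h).trans (hM n)
  have hM0 : 0 ≤ M / mu := div_nonneg (((u 0).elastic_nonneg hB hmu h).trans (hM 0)) hmu.le
  -- One constant serves gradients and fields: Poincaré costs at most `2 * K`, and the 1 covers the
  -- gradient entries.
  have hg : ∀ n i j, ∫ x in cell B, (u n).grad x i j ^ 2 ≤ (1 + 2 * K) * (M / mu) := fun n i j =>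
    (((u n).integral_grad_sq_le i j).trans (hS n)).trans
      (le_mul_of_one_le_left hM0 (by linarith))
  have hf : ∀ n i, ∫ x in cell B, (u n).toFun x i ^ 2 ≤ (1 + 2 * K) * (M / mu) := fun n i => by
    refine ((hu n).integral_sq_le hB i).trans ?_
    have h1 := ((u n).integral_grad_sq_le i 0).trans (hS n)
    have h2 := ((u n).integral_grad_sq_le i 1).trans (hS n)
    calc _ ≤ K * (M / mu + M / mu) := by
          refine mul_le_mul_of_nonneg_left ?_ hK
          rw [Fin.sum_univ_two]
          exact add_le_add h1 h2
      _ ≤ (1 + 2 * K) * (M / mu) := by linarith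
  obtain ⟨φ, hφ, h0⟩ := exists_subseq_integral_sq_sub_le hB (fun n => (u n).memLp 0)
    (fun n => (u n).grad_memLp 0) (fun n => (u n).weak_grad 0) (fun n => hf n 0) (fun n => hg n 0)
  -- The second component is treated along the subsequence already chosen for the first.
  obtain ⟨ψ, hψ, h1⟩ := exists_subseq_integral_sq_sub_le hB (fun n => (u (φ n)).memLp 1)
    (fun n => (u (φ n)).grad_memLp 1) (fun n => (u (φ n)).weak_grad 1) (fun n => hf (φ n) 1)
    (fun n => hg (φ n) 1)
  refine ⟨φ ∘ ψ, hφ.comp hψ, Fin.forall_fin_two.mpr ⟨fun ε hε => ?_, h1⟩⟩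
  obtain ⟨N, hN⟩ := h0 ε hε
  exact ⟨N, fun m hm n hn =>
    hN _ (hm.trans (hψ.id_le m)) _ (hn.trans (hψ.id_le n))⟩

/-- By Korn's identity the energy is a finite combination of integrals of products of gradient
entries, each continuous in `L²`. -/
lemma tendsto_elastic (hB : B.det ≠ 0) (lam mu : ℝ) {u : ℕ → SobolevField B} {v : SobolevField B}
    (h : ∀ i j, Tendsto (fun n => ∫ x in cell B, ((u n).grad x i j - v.grad x i j) ^ 2)
      atTop (𝓝 0)) :
    Tendsto (fun n => (u n).elastic lam mu) atTop (𝓝 (v.elastic lam mu)) := by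
  have hp : ∀ i j k l, Tendsto (fun n => ∫ x in cell B, (u n).grad x i j * (u n).grad x k l)
      atTop (𝓝 (∫ x in cell B, v.grad x i j * v.grad x k l)) := fun i j k l =>
    tendsto_integral_mul_of_tendsto_integral_sq (fun n => (u n).grad_memLp i j) (v.grad_memLp i j)
      (fun n => (u n).grad_memLp k l) (v.grad_memLp k l) (h i j) (h k l)
  have hd : ∀ w : SobolevField B, ∫ x in cell B, w.div x ^ 2
      = (∫ x in cell B, w.grad x 0 0 * w.grad x 0 0)
        + (2 * (∫ x in cell B, w.grad x 0 0 * w.grad x 1 1)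
        + ∫ x in cell B, w.grad x 1 1 * w.grad x 1 1) := fun w => by
    have i1 := w.integrable_grad_mul_grad 0 0 0 0
    have i2 := (w.integrable_grad_mul_grad 0 0 1 1).const_mul 2
    have i3 := w.integrable_grad_mul_grad 1 1 1 1
    have i23 : Integrable (fun x => 2 * (w.grad x 0 0 * w.grad x 1 1)
      + w.grad x 1 1 * w.grad x 1 1) (volume.restrict (cell B)) := i2.add i3
    rw [← integral_const_mul, ← integral_add i2 i3, ← integral_add i1 i23]
    congr 1
    funext x
    rw [div, Matrix.trace_fin_two]
    ring
  simp only [elastic_eq hB, hd]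
  simp only [sq]
  exact ((tendsto_finsetSum _ fun i _ => tendsto_finsetSum _ fun j _ => hp i j i j).const_mul mu).add
    (((hp 0 0 0 0).add (((hp 0 0 1 1).const_mul 2).add (hp 1 1 1 1))).const_mul _)

/-- Existence of a minimizer, by the direct method. -/
lemma exists_isMinimizer (hB : B.det ≠ 0) {lam mu : ℝ} (hmu : 0 < mu) (h : 0 ≤ lam + mu)
    {Ψ : Plane → ℝ} (hc : ContDiff ℝ 1 Ψ) (hp : LatticePeriodic B Ψ) (θ : ℝ) :
    ∃ u : SobolevField B, IsMinimizer lam mu Ψ θ u := by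
  obtain ⟨L, hL, hF⟩ := exists_interEnergy_sub_le θ hB hp hc
  set F : SobolevField B → ℝ := fun u => interEnergy B Ψ θ (fun x => (2 : ℝ) • u.toFun x) with hFdef
  set b := 1 / (4 * Real.sin (θ / 2) ^ 2) * ∫ _ in cell B, ⨅ y, Ψ y
  have hFb : ∀ u, b ≤ F u := fun u =>
    le_interEnergy θ hB hp hc.continuous (u.aestronglyMeasurable.const_smul (2 : ℝ))
  have hE : ∀ u : SobolevField B, totalEnergy lam mu Ψ θ u = u.elastic lam mu + F u :=
    totalEnergy_eq lam mu Ψ θ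
  set S := {e | ∃ u : SobolevField B, u.MeanZero ∧ totalEnergy lam mu Ψ θ u = e} with hSdef
  have hSne : S.Nonempty := ⟨_, zero B, fun i => by simp [zero], rfl⟩
  have hSb : BddBelow S := ⟨b, by
    rintro _ ⟨u, -, rfl⟩
    rw [hE]
    linarith [hFb u, u.elastic_nonneg hB hmu h]⟩
  set e₀ := sInf S with he₀
  have hmin : ∀ u : SobolevField B, u.MeanZero → e₀ ≤ totalEnergy lam mu Ψ θ u :=
    fun u hu => csInf_le hSb ⟨u, hu, rfl⟩
  obtain ⟨e, -, hlim, hmem⟩ := exists_seq_tendsto_sInf hSne hSb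
  choose w hw0 hwe using hmem
  obtain ⟨M, hM⟩ := hlim.bddAbove_range
  obtain ⟨φ, hφ, hcauchy⟩ := exists_subseq_cauchy_of_elastic_le hB hmu h hw0 (M := M - b)
    fun n => by
      have h1 := hM ⟨n, rfl⟩
      rw [← hwe n, hE] at h1
      linarith [hFb (w n)]
  set u : ℕ → SobolevField B := fun n => w (φ n)
  have hu0 : ∀ n, (u n).MeanZero := fun n => hw0 _
  have hulim : Tendsto (fun n => totalEnergy lam mu Ψ θ (u n)) atTop (𝓝 e₀) := by
    simp only [u, hwe]
    exact hlim.comp hφ.tendsto_atTop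
  -- Two late terms are nearly optimal and their midpoint cannot beat the infimum. Up to the small
  -- change in misfit, the parallelogram law therefore leaves little elastic energy for their
  -- difference.
  have hgrad : ∀ i j, ∀ ε > 0, ∃ N, ∀ m ≥ N, ∀ n ≥ N,
      ∫ x in cell B, ((u m).grad x i j - (u n).grad x i j) ^ 2 ≤ ε := by
    intro i j ε hε
    -- Chosen so that the final estimate `4 * (δ + L * δ)` equals `mu * ε`.
    set δ := mu * ε / (4 * (1 + L)) with hδ
    have hδ0 : 0 < δ := by positivity
    obtain ⟨N0, hN0⟩ := hcauchy 0 (δ ^ 2) (by positivity)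
    obtain ⟨N1, hN1⟩ := hcauchy 1 (δ ^ 2) (by positivity)
    obtain ⟨N2, hN2⟩ := eventually_atTop.mp
      (hulim.eventually (gt_mem_nhds (lt_add_of_pos_right e₀ hδ0)))
    refine ⟨max N0 (max N1 N2), fun m hm n hn => ?_⟩
    simp only [ge_iff_le, max_le_iff] at hm hn
    set mid := (u m).linComb hB (1 / 2) (1 / 2) (u n)
    set dif := (u m).linComb hB 1 (-1) (u n)
    have hpar := elastic_parallelogram hB lam mu (u m) (u n)
    have hmid := hmin mid ((hu0 m).linComb (hu0 n))
    have hdist : ∀ i, ∫ x in cell B, ((u m).toFun x i - (u n).toFun x i) ^ 2 ≤ δ ^ 2 :=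
      Fin.forall_fin_two.mpr ⟨hN0 m hm.1 n hn.1, hN1 m hm.2.1 n hn.2.1⟩
    -- The midpoint is half the difference away from either endpoint, so each of the two components
    -- contributes at most `δ / 2`.
    have hsqrt : ∀ v : SobolevField B, (∀ x i, (mid.toFun x i - v.toFun x i) ^ 2
        = 1 / 4 * ((u m).toFun x i - (u n).toFun x i) ^ 2) → |F mid - F v| ≤ L * δ := by
      intro v hv
      refine (hF mid v).trans (mul_le_mul_of_nonneg_left ?_ hL)
      have : ∀ i, Real.sqrt (∫ x in cell B, (mid.toFun x i - v.toFun x i) ^ 2) ≤ δ / 2 := fun i => by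
        refine Real.sqrt_le_iff.mpr ⟨by positivity, ?_⟩
        simp only [hv, integral_const_mul]
        linarith [hdist i]
      rw [Fin.sum_univ_two]
      linarith [this 0, this 1]
    have hF1 := abs_le.mp (hsqrt (u m) fun x i => by
      simp only [mid, linComb, Pi.add_apply, Pi.smul_apply, smul_eq_mul]; ring)
    have hF2 := abs_le.mp (hsqrt (u n) fun x i => by
      simp only [mid, linComb, Pi.add_apply, Pi.smul_apply, smul_eq_mul]; ring)
    have hm2 := hN2 m hm.2.2
    have hn2 := hN2 n hn.2.2
    rw [hE] at hmid hm2 hn2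
    have hdif : dif.elastic lam mu ≤ mu * ε := by
      have : mu * ε = 4 * (δ + L * δ) := by rw [hδ]; field_simp
      linarith [hF1.2, hF2.2]
    have hle := (mul_le_mul_of_nonneg_left (dif.integral_grad_sq_le i j) hmu.le).trans
      ((dif.mul_sum_integral_grad_sq_le_elastic hB h).trans hdif)
    have heq : ∫ x in cell B, dif.grad x i j ^ 2
        = ∫ x in cell B, ((u m).grad x i j - (u n).grad x i j) ^ 2 := by
      congr 1
      funext x
      simp only [dif, linComb, Matrix.add_apply, Matrix.smul_apply, smul_eq_mul]
      ring
    rw [← heq]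
    exact le_of_mul_le_mul_left hle hmu
  obtain ⟨v, hv, hvg⟩ := exists_tendsto_of_cauchy hB u hcauchy hgrad
  -- The mean is the pairing with the constant 1, hence continuous in `L²`.
  have hv0 : v.MeanZero := fun i => by
    have := tendsto_integral_mul_right_of_tendsto_integral_sq (fun n => (u n).memLp i) (v.memLp i)
      (memLp_const (1 : ℝ)) (hv i)
    simp only [mul_one, hu0 _ i] at this
    exact (tendsto_nhds_unique tendsto_const_nhds this).symm
  have hFlim : Tendsto (fun n => F (u n)) atTop (𝓝 (F v)) := by
    rw [tendsto_iff_norm_sub_tendsto_zero]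
    refine squeeze_zero (fun n => norm_nonneg _) (fun n => hF (u n) v) ?_
    have := (tendsto_finsetSum Finset.univ fun i _ => (hv i).sqrt).const_mul L
    simpa using this
  have hElim : Tendsto (fun n => totalEnergy lam mu Ψ θ (u n)) atTop
      (𝓝 (totalEnergy lam mu Ψ θ v)) := by
    simp only [hE]
    exact (tendsto_elastic hB lam mu hvg).add hFlim
  refine ⟨v, hv0, fun z hz => ?_⟩
  rw [tendsto_nhds_unique hElim hulim]
  exact hmin z hz

/-- The a priori bound for minimizers, obtained by comparison with the zero field. -/
lemma IsMinimizer.norm12_le (hB : B.det ≠ 0) {C : ℝ} (hC : 0 < C) (hK : KornInequality B C)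
    {lam mu : ℝ} (hmu : 0 < mu) (h : 0 ≤ lam + mu) {Ψ : Plane → ℝ} (hc : Continuous Ψ)
    (hp : LatticePeriodic B Ψ) {θ : ℝ} {u : SobolevField B} (hu : IsMinimizer lam mu Ψ θ u) :
    u.norm12 ≤ 1 / (2 * |Real.sin (θ / 2)|) *
      Real.sqrt (1 / (mu * C) * ∫ x in cell B, (Ψ x - ⨅ y, Ψ y)) := by
  have hz := hu.2 (zero B) fun i => by simp [zero]
  have hzero : totalEnergy lam mu Ψ θ (zero B)
      = 1 / (4 * Real.sin (θ / 2) ^ 2) * ∫ x in cell B, Ψ x := by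
    rw [totalEnergy_eq, interEnergy_eq, elastic_eq hB]
    simp [zero, misfit, div, ← two_mul]
  rw [hzero, totalEnergy_eq] at hz
  have hkorn := hK lam mu hmu h u hu.1
  have hlow := le_interEnergy θ hB hp hc (u.aestronglyMeasurable.const_smul (2 : ℝ))
  have hsub : ∫ x in cell B, (Ψ x - ⨅ y, Ψ y)
      = (∫ x in cell B, Ψ x) - ∫ _ in cell B, ⨅ y, Ψ y :=
    integral_sub ((hp.memLp hB hc).integrable one_le_two) (integrable_const _)
  have hle : mu * C * u.norm12 ^ 2
      ≤ 1 / (4 * Real.sin (θ / 2) ^ 2) * ∫ x in cell B, (Ψ x - ⨅ y, Ψ y) := by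
    rw [hsub, mul_sub]
    change mu * C * u.norm12 ^ 2 ≤ u.elastic lam mu at hkorn
    have hlow' : 1 / (4 * Real.sin (θ / 2) ^ 2) * ∫ _ in cell B, ⨅ y, Ψ y
      ≤ interEnergy B Ψ θ (fun x => (2 : ℝ) • u.toFun x) := hlow
    linarith
  -- If the sine vanishes, both sides are 0 by the convention for division by zero, so no case split
  -- is needed.
  have hs : 1 / (2 * |Real.sin (θ / 2)|) = Real.sqrt (1 / (4 * Real.sin (θ / 2) ^ 2)) := by
    rw [← Real.sqrt_sq (by positivity : 0 ≤ 1 / (2 * |Real.sin (θ / 2)|)), div_pow, mul_pow, sq_abs]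
    norm_num
  rw [hs, ← Real.sqrt_mul (by positivity)]
  refine Real.le_sqrt_of_sq_le ?_
  rw [mul_left_comm, one_div_mul_eq_div (mu * C), le_div_iff₀ (mul_pos hmu hC), mul_comm]
  exact hle

lemma det_refBasis_ne_zero {A : Matrix (Fin 2) (Fin 2) ℝ} (hA : A.det ≠ 0) :
    (refBasis A).det ≠ 0 := by
  rw [refBasis, Matrix.det_mul]
  simpa [matJ, Matrix.det_fin_two] using hA

/-- Jordan's inequality `(2/π) |x| ≤ |sin x|` at `x = θ/2`, where `|x| ≤ π/2`. -/
lemma abs_le_pi_mul_abs_sin_half {θ : ℝ} (h : |θ| ≤ Real.pi) :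
    |θ| ≤ Real.pi * |Real.sin (θ / 2)| := by
  have h1 := Real.mul_abs_le_abs_sin (x := θ / 2) (by rw [abs_div, abs_two]; linarith)
  rw [abs_div, abs_two] at h1
  have h2 := mul_le_mul_of_nonneg_left h1 Real.pi_pos.le
  have h3 : Real.pi * (2 / Real.pi * (|θ| / 2)) = |θ| := by field_simp
  linarith

end TwistedBilayer

/-! ### Assembly of the theorem -/

open TwistedBilayer
theorem theorem4p1 (A : Matrix (Fin 2) (Fin 2) ℝ) (hA : A.det ≠ 0) :
    ∃ C : ℝ, 0 < C ∧ IsGreatest {c : ℝ | KornInequality (refBasis A) c} C ∧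
      ∀ (lam mu : ℝ), 0 < mu → 0 ≤ lam + mu →
      ∀ Ψ : Plane → ℝ, ContDiff ℝ 2 Ψ → LatticePeriodic (refBasis A) Ψ →
      ∀ θ : ℝ, (∀ k : ℤ, θ ≠ k * Real.pi) →
        (∃ u : SobolevField (refBasis A), IsMinimizer lam mu Ψ θ u) ∧
        ∀ u : SobolevField (refBasis A), IsMinimizer lam mu Ψ θ u →
          u.norm12 ≤ 1 / (2 * |Real.sin (θ / 2)|) *
            Real.sqrt (1 / (mu * C) * ∫ x in cell (refBasis A), (Ψ x - ⨅ y, Ψ y)) ∧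
          (|θ| < Real.pi →
            u.gradNorm ≤ Real.pi / (2 * |θ|) *
              Real.sqrt (1 / (mu * C) * ∫ x in cell (refBasis A), (Ψ x - ⨅ y, Ψ y))) := by
  have hB := det_refBasis_ne_zero hA
  obtain ⟨C, hC, hgreat⟩ := exists_isGreatest_kornInequality hB
  refine ⟨C, hC, hgreat, fun lam mu hmu h Ψ hΨ hp θ hθ =>
    ⟨exists_isMinimizer hB hmu h (hΨ.of_le (by norm_num)) hp θ, fun u hu => ?_⟩⟩
  have hbound := hu.norm12_le hB hC hgreat.1 hmu h hΨ.continuous hp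
  refine ⟨hbound, fun hlt => u.gradNorm_le_norm12.trans (hbound.trans
    (mul_le_mul_of_nonneg_right ?_ (Real.sqrt_nonneg _)))⟩
  have hθ0 : 0 < |θ| := abs_pos.mpr (by simpa using hθ 0)
  have hsin := abs_le_pi_mul_abs_sin_half hlt.le
  have hs0 : 0 < |Real.sin (θ / 2)| := by
    by_contra! hcon
    nlinarith [Real.pi_pos]
  -- Comparing the prefactors `1 / (2 |sin (θ/2)|)` and `π / (2 |θ|)` amounts to `|θ| ≤ π |sin
  -- (θ/2)|`.
  rw [div_le_div_iff₀ (by positivity) (by positivity)]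
  linarith
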